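/- Throughout, $\log$ is the logarithm to base two. For $m\ge 1$ let $\lambda_m$ be the largest (real) eigenvalue of the $m\times m$ matrix $A_m$ whose row $j$ ($0\le j\le m-1$) is $$\Big(\tbinom{m}{\ge 2j+1},\ \tbinom{m}{2j},\ \tbinom{m}{2j-1},\ \dots,\ \tbinom{m}{2j-m+2}\Big),$$ where $\binom{m}{\ge b}=\sum_{i\ge b}\binom{m}{i}$ and $\binom{m}{b}=0$ for $b<0$ or $b>m$. For a real number $k\ge 0$, a binary $k$-PIR code of length $N$ and dimension $n$ is the image of an encoding map $F:\{0,1\}^n\to\{0,1\}^N$ such that for every $i\in\{1,\dots,n\}$ there are $\lceil k\rceil$ mutually disjoint sets $R_1,\dots,R_{\lceil k\rceil}\subseteq\{1,\dots,N\}$ and functions $g_1,\dots,g_{\lceil k\rceil}$ with $g_j(F(x)|_{R_j})=x_i$ for all $x\in\{0,1\}^n$ and all $j$. Let $r(n,k)$ be the smallest value of $N-n$ over all binary $k$-PIR codes of dimension $n$. (1) For every positive integer $m$ there is a constant $C_m$ such that for all real $\varepsilon$ with $0<\varepsilon<\frac{m-1}{m}$ and all real $\delta>0$ there is $n_0$ such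 that for every integer $n\ge n_0$ there is a binary $n^{\varepsilon-\delta}$-PIR code of dimension $n$ whose length $N$ satisfies $$N-n\le C_m\, n^{\frac{m-1/2}{m}+\frac{\varepsilon(1/2+\log\lambda_m-m)}{m-1}} .$$ (2) For every real $\varepsilon$ with $0<\varepsilon<1$, the minimum below is attained and $$\limsup_{n\to\infty}\ \log_n r(n,n^{\varepsilon})\ \le\ \min_{m\ge\lceil 1/(1-\varepsilon)\rceil}\left(\frac{2m-1}{2m}+\frac{1+2\log\lambda_m-2m}{2m-2}\,\varepsilon\right).$$ -/

import Mathlib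

/-- An encoding map `F : A ^ n → A ^ N` is (the encoder of) a `k`-PIR code of length `N` and
dimension `n` over the alphabet `A`: for every message position `i` there are `k` mutually disjoint
sets of code positions and, for each of them, a function that computes the message symbol `x i`
from the projection of the codeword `F x` onto that set. -/
def IsPIRCode {A : Type*} {n N : ℕ} (F : (Fin n → A) → (Fin N → A)) (k : ℕ) : Prop :=
  ∀ i : Fin n, ∃ R : Fin k → Finset (Fin N),
    (∀ j l : Fin k, j ≠ l → Disjoint (R j) (R l)) ∧
    ∃ g : (j : Fin k) → ({p : Fin N // p ∈ R j} → A) → A,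
      ∀ (x : Fin n → A) (j : Fin k), g j (fun p => F x p.1) = x i

/-- The smallest length of a `k`-PIR code of dimension `n` over an alphabet of size `q`. -/
noncomputable def pirLength (q n k : ℕ) : ℕ :=
  sInf {N : ℕ | ∃ F : (Fin n → Fin q) → (Fin N → Fin q), IsPIRCode F k}

/-- The minimal redundancy of a `k`-PIR code of dimension `n` over an alphabet of size `q`. -/
noncomputable def pirRedundancy (q n k : ℕ) : ℝ :=
  (pirLength q n k : ℝ) - (n : ℝ)

/-- The `m × m` matrix whose row `j` (counted from `0`) is
`(binom(m, ≥ 2j+1), binom(m, 2j), binom(m, 2j-1), …, binom(m, 2j-m+2))`, where `binom(m, ≥ b)`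
is the number of subsets with at least `b` elements of a set with `m` elements. -/
def carryMatrix (m : ℕ) : Matrix (Fin m) (Fin m) ℝ :=
  Matrix.of fun j c =>
    if (c : ℕ) = 0 then ∑ i ∈ Finset.Icc (2 * (j : ℕ) + 1) m, (m.choose i : ℝ)
    else if (c : ℕ) ≤ 2 * (j : ℕ) + 1 then (m.choose (2 * (j : ℕ) + 1 - (c : ℕ)) : ℝ)
    else 0

/-- The largest eigenvalue of the matrix `carryMatrix m`. -/
noncomputable def topEigenvalue (m : ℕ) : ℝ :=
  sSup {x : ℝ | Module.End.HasEigenvalue (Matrix.toLin' (carryMatrix m)) x}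

/-! ### PIR codes from kernels of linear maps -/

/-- Systematic encoding of a shortened kernel: a maximal independent set `S` of columns of `Φ` holds
the parity symbols, `J` holds the message, and all other coordinates are zero. Two codewords that
agree on a recovering set have a difference to which `hrec` applies. -/
theorem exists_pirCode_of_linearMap {K ι W : Type*} [Field K] [Fintype ι] [AddCommGroup W]
    [Module K W] (Φ : (ι → K) →ₗ[K] W) {k n r : ℕ}
    (hr : Module.finrank K (LinearMap.range Φ) ≤ r) (hn : n + r ≤ Fintype.card ι)
    (hrec : ∀ p : ι, ∃ R : Fin k → Set ι, (∀ j l, j ≠ l → Disjoint (R j) (R l)) ∧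
      ∀ (j : Fin k) (c : ι → K), Φ c = 0 → (∀ i ∈ R j, c i = 0) → c p = 0) :
    ∃ (N : ℕ) (F : (Fin n → K) → (Fin N → K)), IsPIRCode F k ∧ N ≤ n + r := by
  classical
  obtain ⟨κ, a, ha, hspan, hli⟩ := exists_linearIndependent' K (fun i : ι => Φ (Pi.single i 1))
  have : Finite κ := Finite.of_injective a ha
  have := Fintype.ofFinite κ
  have hrange : Submodule.span K (Set.range fun i : ι => Φ (Pi.single i 1)) = LinearMap.range Φ := by
    rw [LinearMap.range_eq_map, ← (Pi.basisFun K ι).span_eq, Submodule.map_span, ← Set.range_comp]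
    congr 2
  set S : Finset ι := Finset.univ.image a with hS
  have hScard : S.card = Fintype.card κ := by
    rw [hS, Finset.card_image_of_injective _ ha, Finset.card_univ]
  have hκ : Fintype.card κ ≤ r := by
    rw [← finrank_span_eq_card hli, hspan, hrange]
    exact hr
  obtain ⟨J, hJS, hJcard⟩ : ∃ J ⊆ Sᶜ, J.card = n :=
    Finset.exists_subset_card_eq (by rw [Finset.card_compl]; omega)
  have hdisj : Disjoint J S := by
    rw [Finset.disjoint_left]
    intro i hi
    exact Finset.mem_compl.1 (hJS hi)
  let eJ : Fin n ≃ J := (finCongr hJcard.symm).trans J.equivFin.symm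
  let eU : Fin (J ∪ S).card ≃ (J ∪ S : Finset ι) := (J ∪ S).equivFin.symm
  have hcode : ∀ x : Fin n → K, ∃ c : ι → K, Φ c = 0 ∧ (∀ i, c (eJ i) = x i) ∧
      ∀ i, i ∉ J ∪ S → c i = 0 := by
    intro x
    let c₀ : ι → K := fun i => if h : i ∈ J then x (eJ.symm ⟨i, h⟩) else 0
    have hmem : Φ c₀ ∈ Submodule.span K (Set.range ((fun i : ι => Φ (Pi.single i 1)) ∘ a)) := by
      rw [hspan, hrange]
      exact LinearMap.mem_range_self _ _
    obtain ⟨w, hw⟩ := (Submodule.mem_span_range_iff_exists_fun K).1 hmem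
    refine ⟨c₀ - ∑ t, w t • Pi.single (a t) 1, ?_, ?_, ?_⟩
    · rw [map_sub, map_sum, ← hw]
      simp
    · intro i
      have h0 : ∀ t, (Pi.single (a t) (1 : K) : ι → K) (eJ i) = 0 := by
        intro t
        refine Pi.single_eq_of_ne ?_ _
        intro h
        exact Finset.disjoint_left.1 hdisj (eJ i).2 (h ▸ by simp [hS])
      simp [c₀, h0]
    · intro i hi
      rw [Finset.mem_union, not_or] at hi
      have h0 : ∀ t, (Pi.single (a t) (1 : K) : ι → K) i = 0 := by
        intro t
        refine Pi.single_eq_of_ne ?_ _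
        intro h
        exact hi.2 (h ▸ by simp [hS])
      simp [c₀, h0, hi.1]
  choose c hc0 hcJ hcU using hcode
  refine ⟨(J ∪ S).card, fun x p => c x (eU p), ?_, ?_⟩
  · intro i
    obtain ⟨R, hRd, hR⟩ := hrec (eJ i)
    refine ⟨fun j => Finset.univ.filter fun p => (eU p : ι) ∈ R j, ?_, ?_⟩
    · intro j l hjl
      rw [Finset.disjoint_left]
      intro p hp hp'
      rw [Finset.mem_filter] at hp hp'
      exact Set.disjoint_left.1 (hRd j l hjl) hp.2 hp'.2
    · have key : ∀ j : Fin k, ∃ g : ({p // p ∈ Finset.univ.filter fun p => (eU p : ι) ∈ R j} → K) → K,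
          ∀ x, g (fun p => c x (eU p.1)) = x i := by
        intro j
        refine ⟨Function.extend (fun x p => c x (eU p.1)) (fun x => x i) 0, fun x => ?_⟩
        refine Function.FactorsThrough.extend_apply ?_ _ _
        intro x y hxy
        have := hR j (c x - c y) (by rw [map_sub, hc0, hc0, sub_zero]) ?_
        · rw [Pi.sub_apply, hcJ, hcJ] at this
          exact sub_eq_zero.1 this
        · intro z hz
          by_cases hzU : z ∈ J ∪ S
          · have := congrFun hxy ⟨eU.symm ⟨z, hzU⟩, by simpa using hz⟩
            simpa [sub_eq_zero] using this
          · simp [hcU _ _ hzU]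
      choose g hg using key
      exact ⟨g, fun x j => hg j x⟩
  · rw [Finset.card_union_of_disjoint hdisj]
    omega

/-! ### Entries and row sums of the carry matrix -/

theorem carryMatrix_nonneg (m : ℕ) (j c : Fin m) : 0 ≤ carryMatrix m j c := by
  unfold carryMatrix
  simp only [Matrix.of_apply]
  split_ifs <;> positivity

theorem carryMatrix_zero_zero {m : ℕ} (hm : 0 < m) :
    carryMatrix m ⟨0, hm⟩ ⟨0, hm⟩ = 2 ^ m - 1 := by
  have h := Nat.sum_range_choose m
  rw [Finset.sum_range_succ'] at h
  have h2 : ∑ i ∈ Finset.Icc 1 m, (m.choose i : ℝ) = ∑ k ∈ Finset.range m, (m.choose (k + 1) : ℝ) := by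
    rw [Finset.range_eq_Ico, Finset.sum_Ico_add' (fun i => (m.choose i : ℝ)) 0 m 1]
    rfl
  have h3 : (∑ k ∈ Finset.range m, (m.choose (k + 1) : ℝ)) + 1 = 2 ^ m := by
    rw [Nat.choose_zero_right] at h
    exact_mod_cast h
  simp only [carryMatrix, Matrix.of_apply, if_true, mul_zero, zero_add]
  linarith

/-- Different columns of a row use disjoint sets of lower indices: column 0 those above `2 * j`,
every other column a single one up to `2 * j`. -/
theorem carryMatrix_row_sum_le (m : ℕ) (j : Fin m) : ∑ c, carryMatrix m j c ≤ 2 ^ m := by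
  obtain ⟨m, rfl⟩ : ∃ k, m = k + 1 := ⟨m - 1, by have := j.2; omega⟩
  rw [Fin.sum_univ_succ]
  set S : Finset (Fin m) := Finset.univ.filter fun c => (c : ℕ) ≤ 2 * (j : ℕ) with hS
  have h1 : ∑ c : Fin m, carryMatrix (m + 1) j c.succ =
      ∑ c ∈ S, ((m + 1).choose (2 * (j : ℕ) - c) : ℝ) := by
    rw [hS, Finset.sum_filter]
    refine Finset.sum_congr rfl fun c _ => ?_
    simp only [carryMatrix, Matrix.of_apply, Fin.val_succ]
    rw [if_neg (Nat.succ_ne_zero _)]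
    congr 1
    · simp
    · rw [Nat.add_sub_add_right]
  have h2 : ∑ c ∈ S, ((m + 1).choose (2 * (j : ℕ) - c) : ℝ) =
      ∑ i ∈ S.image fun c : Fin m => 2 * (j : ℕ) - c, ((m + 1).choose i : ℝ) := by
    rw [Finset.sum_image]
    intro x hx y hy hxy
    have hx' := (Finset.mem_filter.1 hx).2
    have hy' := (Finset.mem_filter.1 hy).2
    ext
    simp only at hxy
    omega
  have h3 : carryMatrix (m + 1) j 0 =
      ∑ i ∈ Finset.Icc (2 * (j : ℕ) + 1) (m + 1), ((m + 1).choose i : ℝ) := by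
    simp [carryMatrix]
  rw [h1, h2, h3, ← Finset.sum_union]
  · have h4 := Nat.sum_range_choose (m + 1)
    have h5 : ∑ i ∈ Finset.range (m + 1 + 1), ((m + 1).choose i : ℝ) = 2 ^ (m + 1) := by
      exact_mod_cast h4
    rw [← h5, ← Finset.sum_filter_ne_zero]
    refine Finset.sum_le_sum_of_subset_of_nonneg (fun i hi => ?_) fun i _ _ => Nat.cast_nonneg _
    rw [Finset.mem_range]
    by_contra hlt
    exact (Finset.mem_filter.1 hi).2 (by rw [Nat.choose_eq_zero_of_lt (by omega), Nat.cast_zero])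
  · rw [Finset.disjoint_left]
    intro i hi hi'
    rw [Finset.mem_image] at hi'
    obtain ⟨c, -, rfl⟩ := hi'
    rw [Finset.mem_Icc] at hi
    omega

/-! ### Perron-type estimates for nonnegative matrices -/

section Perron

variable {ι : Type*} [Fintype ι] [DecidableEq ι] {A : Matrix ι ι ℝ}

/-- Above the real spectrum the resolvent of a nonnegative matrix is positive on `1`. -/
theorem exists_pos_resolvent_of_nonneg (hA : ∀ i j, 0 ≤ A i j) {t₀ t : ℝ}
    (h : ∀ x, Module.End.HasEigenvalue (Matrix.toLin' A) x → x ≤ t₀) (ht : t₀ < t) :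
    ∃ v : ι → ℝ, (∀ i, 0 < v i) ∧ ∀ i, A.mulVec v i = t * v i - 1 := by
  rcases isEmpty_or_nonempty ι with hι | hι
  · exact ⟨0, fun i => isEmptyElim i, fun i => isEmptyElim i⟩
  set B : ℝ → Matrix ι ι ℝ := fun t => t • (1 : Matrix ι ι ℝ) - A with hB
  have hdet : ∀ t, t₀ < t → (B t).det ≠ 0 := by
    intro t ht hdet
    obtain ⟨w, hw0, hw⟩ := Matrix.exists_mulVec_eq_zero_iff.2 hdet
    refine not_le.2 ht (h t (Module.End.hasEigenvalue_of_hasEigenvector (x := w)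
      (Module.End.hasEigenvector_iff.2 ⟨?_, hw0⟩)))
    rw [Module.End.mem_eigenspace_iff, Matrix.toLin'_apply]
    rw [hB] at hw
    simp only [Matrix.sub_mulVec, Matrix.smul_mulVec, Matrix.one_mulVec] at hw
    exact (sub_eq_zero.1 hw).symm
  set v : ℝ → ι → ℝ := fun t => (B t)⁻¹.mulVec 1 with hv
  have hres : ∀ t, t₀ < t → ∀ i, A.mulVec (v t) i = t * v t i - 1 := by
    intro t ht i
    have h1 : (B t).mulVec (v t) = 1 := by
      rw [hv]
      simp only [Matrix.mulVec_mulVec]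
      rw [Matrix.mul_nonsing_inv _ (isUnit_iff_ne_zero.2 (hdet t ht)), Matrix.one_mulVec]
    have h2 := congrFun h1 i
    simp only [hB, Matrix.sub_mulVec, Matrix.smul_mulVec, Matrix.one_mulVec, Pi.sub_apply,
      Pi.smul_apply, smul_eq_mul, Pi.one_apply] at h2
    linarith
  have hcont : ∀ i, ContinuousOn (fun t => v t i) (Set.Ioi t₀) := by
    intro i
    have hBc : Continuous B := by
      rw [hB]
      fun_prop
    have h1 : (fun t => v t i) = fun t => (B t).det⁻¹ * ((B t).adjugate.mulVec 1) i := by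
      funext t
      simp only [hv, Matrix.inv_def, Ring.inverse_eq_inv', Matrix.smul_mulVec, Pi.smul_apply,
        smul_eq_mul]
    rw [h1]
    refine ContinuousOn.mul (ContinuousOn.inv₀ hBc.matrix_det.continuousOn fun t ht => hdet t ht) ?_
    exact ((continuous_apply i).comp
      (hBc.matrix_adjugate.matrix_mulVec continuous_const)).continuousOn
  have hpos : ∀ t, t₀ < t → (∀ i, 0 ≤ v t i) → ∀ i, 0 < v t i := by
    intro t ht hnn i
    have h1 : 0 ≤ A.mulVec (v t) i := Finset.sum_nonneg fun j _ => mul_nonneg (hA i j) (hnn j)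
    have h2 := hres t ht i
    by_contra h3
    have h4 : v t i = 0 := le_antisymm (not_lt.1 h3) (hnn i)
    rw [h4] at h2
    linarith
  -- The least entry of the resolvent vector is continuous in `t` and positive beyond all row sums.
  -- It cannot vanish on the way, because `hpos` makes a nonnegative resolvent vector strictly
  -- positive.
  set g : ℝ → ℝ := fun t => Finset.univ.inf' Finset.univ_nonempty (fun i => v t i) with hg
  have hgc : ContinuousOn g (Set.Ioi t₀) :=
    ContinuousOn.finset_inf'_apply _ fun i _ => hcont i
  have hglt : ∀ t i, g t ≤ v t i := fun t i => Finset.inf'_le _ (Finset.mem_univ i)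
  set R : ℝ := ∑ i, ∑ j, A i j with hR
  have hRi : ∀ i, ∑ j, A i j ≤ R := fun i =>
    Finset.single_le_sum (f := fun i => ∑ j, A i j)
      (fun i _ => Finset.sum_nonneg fun j _ => hA i j) (Finset.mem_univ i)
  set T : ℝ := max t R + 1 with hT
  have hTt : t < T := by
    have := le_max_left t R
    linarith
  have hTR : R < T := by
    have := le_max_right t R
    linarith
  have hgT : 0 < g T := by
    obtain ⟨i, -, hi⟩ := Finset.exists_mem_eq_inf' Finset.univ_nonempty (fun i => v T i)
    change g T = v T i at hi
    by_contra hneg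
    rw [hi, not_lt] at hneg
    have h1 : v T i * ∑ j, A i j ≤ A.mulVec (v T) i := by
      rw [Finset.mul_sum]
      refine Finset.sum_le_sum fun j _ => ?_
      rw [mul_comm]
      exact mul_le_mul_of_nonneg_left (hi ▸ hglt T j) (hA i j)
    rw [hres T (ht.trans hTt) i] at h1
    have h2 := mul_le_mul_of_nonpos_left (hRi i) hneg
    nlinarith
  have hgt : 0 < g t := by
    by_contra hneg
    rw [not_lt] at hneg
    have hsub : Set.Icc t T ⊆ Set.Ioi t₀ := fun x hx => ht.trans_le hx.1
    obtain ⟨u, hu, hu0⟩ := intermediate_value_Icc hTt.le (hgc.mono hsub) ⟨hneg, hgT.le⟩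
    have h1 := hpos u (hsub hu) fun i => hu0 ▸ hglt u i
    obtain ⟨i, -, hi⟩ := Finset.exists_mem_eq_inf' Finset.univ_nonempty (fun i => v u i)
    change g u = v u i at hi
    have := h1 i
    rw [← hi, hu0] at this
    exact lt_irrefl _ this
  exact ⟨v t, fun i => hgt.trans_le (hglt t i), hres t ht⟩

/-- Gershgorin: a disc centred at a diagonal entry has the sum of the other entries of the row as
radius. -/
theorem eigenvalue_le_of_row_sum_le (hA : ∀ i j, 0 ≤ A i j) {B x : ℝ} (hB : ∀ i, ∑ j, A i j ≤ B)
    (hx : Module.End.HasEigenvalue (Matrix.toLin' A) x) : x ≤ B := by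
  obtain ⟨i, hi⟩ := eigenvalue_mem_ball hx
  rw [Metric.mem_closedBall, Real.dist_eq] at hi
  have h1 : ∑ j ∈ Finset.univ.erase i, ‖A i j‖ = ∑ j ∈ Finset.univ.erase i, A i j :=
    Finset.sum_congr rfl fun j _ => Real.norm_of_nonneg (hA i j)
  rw [h1] at hi
  have h2 := Finset.add_sum_erase Finset.univ (A i) (Finset.mem_univ i)
  have := le_abs_self (x - A i i)
  linarith [hB i]

end Perron

section TopEigenvalue

variable {m : ℕ}

theorem le_topEigenvalue {x : ℝ}
    (hx : Module.End.HasEigenvalue (Matrix.toLin' (carryMatrix m)) x) : x ≤ topEigenvalue m :=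
  le_csSup ⟨2 ^ m, fun _ hy => eigenvalue_le_of_row_sum_le (carryMatrix_nonneg m)
    (carryMatrix_row_sum_le m) hy⟩ hx

theorem topEigenvalue_le (m : ℕ) : topEigenvalue m ≤ 2 ^ m :=
  Real.sSup_le (fun _ hy => eigenvalue_le_of_row_sum_le (carryMatrix_nonneg m)
    (carryMatrix_row_sum_le m) hy) (by positivity)

/-- A strictly positive supersolution suffices for counting, so no positive Perron eigenvector is
needed. -/
theorem exists_pos_mulVec_carryMatrix {t : ℝ} (ht : topEigenvalue m < t) :
    ∃ v : Fin m → ℝ, (∀ i, 0 < v i) ∧ ∀ i, (carryMatrix m).mulVec v i < t * v i := by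
  obtain ⟨v, hv, h⟩ := exists_pos_resolvent_of_nonneg (carryMatrix_nonneg m)
    (fun x hx => le_topEigenvalue hx) ht
  exact ⟨v, hv, fun i => by rw [h i]; linarith⟩

/-- The corner entry equals `2 ^ m - 1`, which rules out a strict supersolution at that value. In
particular the supremum in `topEigenvalue` is not the default value 0 of an empty set. -/
theorem two_pow_sub_one_le_topEigenvalue (hm : 0 < m) : (2 : ℝ) ^ m - 1 ≤ topEigenvalue m := by
  by_contra hlt
  obtain ⟨v, hv, h⟩ := exists_pos_mulVec_carryMatrix (not_le.1 hlt)
  have h2 : carryMatrix m ⟨0, hm⟩ ⟨0, hm⟩ * v ⟨0, hm⟩ ≤ (carryMatrix m).mulVec v ⟨0, hm⟩ :=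
    Finset.single_le_sum (f := fun c => carryMatrix m ⟨0, hm⟩ c * v c)
      (fun c _ => mul_nonneg (carryMatrix_nonneg m _ _) (hv c).le) (Finset.mem_univ _)
  rw [carryMatrix_zero_zero hm] at h2
  exact absurd (h ⟨0, hm⟩) (not_lt.2 h2)

end TopEigenvalue

/-! ### Binary digits and Lucas' theorem -/

/-- Every binary digit of `e` is at most the corresponding binary digit of `d`. -/
def BitLE (e d : ℕ) : Prop := ∀ i, e.testBit i = true → d.testBit i = true

theorem BitLE.mod {e d : ℕ} (h : BitLE e d) (t : ℕ) : BitLE (e % 2 ^ t) (d % 2 ^ t) := by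
  intro i hi
  rw [Nat.testBit_mod_two_pow, Bool.and_eq_true] at hi ⊢
  exact ⟨hi.1, h i hi.2⟩

theorem BitLE.div {e d : ℕ} (h : BitLE e d) (t : ℕ) : BitLE (e / 2 ^ t) (d / 2 ^ t) := by
  intro i hi
  rw [Nat.testBit_div_two_pow] at hi ⊢
  exact h _ hi

theorem BitLE.le {e d : ℕ} (h : BitLE e d) : e ≤ d := by
  have : e &&& d = e := by
    apply Nat.eq_of_testBit_eq
    intro i
    rw [Nat.testBit_and]
    have := h i
    cases h1 : e.testBit i <;> simp_all
  rw [← this]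
  exact Nat.and_le_right

theorem bitLE_of_odd_choose {d : ℕ} : ∀ {e : ℕ}, Odd (d.choose e) → BitLE e d := by
  induction d using Nat.strong_induction_on with
  | _ d ih =>
    intro e h
    rcases Nat.eq_zero_or_pos d with rfl | hd
    · cases e with
      | zero => exact fun i hi => hi
      | succ e => simp at h
    · have hL : d.choose e % 2 = ((d % 2).choose (e % 2) * (d / 2).choose (e / 2)) % 2 :=
        Choose.choose_modEq_choose_mod_mul_choose_div_nat (p := 2) (n := d) (k := e)
      have hodd : Odd ((d % 2).choose (e % 2) * (d / 2).choose (e / 2)) := by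
        rw [Nat.odd_iff] at h ⊢
        omega
      rw [Nat.odd_mul] at hodd
      intro i hi
      cases i with
      | zero =>
        have h1 := hodd.1
        simp only [Nat.testBit_zero, decide_eq_true_eq] at hi ⊢
        rcases Nat.mod_two_eq_zero_or_one d with h0 | h0
        · rw [h0, hi] at h1
          simp at h1
        · exact h0
      | succ i =>
        rw [Nat.testBit_succ] at hi ⊢
        exact ih (d / 2) (by omega) hodd.2 i hi

/-! ### Counting digit strings by carries -/

open Classical in
/-- The tuples of `T`-digit numbers such that suitable digitwise minorants of its entries, together
with a carry less than `m` from the right, sum up to a number whose last `T` digits are all `1` and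
which leaves a carry of at least `j`. -/
noncomputable def carrySet (m T j : ℕ) : Finset (Fin m → ℕ) :=
  (Fintype.piFinset fun _ => Finset.range (2 ^ T)).filter fun x =>
    ∃ e : Fin m → ℕ, (∀ r, BitLE (e r) (x r)) ∧
      ∃ a c : ℕ, a < m ∧ j ≤ c ∧ ∑ r, e r + a + 1 = 2 ^ T * (c + 1)

theorem mem_carrySet {m T j : ℕ} {x : Fin m → ℕ} :
    x ∈ carrySet m T j ↔ (∀ r, x r < 2 ^ T) ∧ ∃ e : Fin m → ℕ, (∀ r, BitLE (e r) (x r)) ∧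
      ∃ a c : ℕ, a < m ∧ j ≤ c ∧ ∑ r, e r + a + 1 = 2 ^ T * (c + 1) := by
  simp [carrySet]

theorem carrySet_eq_empty {m T j : ℕ} (hj : m ≤ j) : carrySet m T j = ∅ := by
  rw [Finset.eq_empty_iff_forall_notMem]
  intro x hx
  obtain ⟨hx, e, he, a, c, ha, hc, h⟩ := mem_carrySet.1 hx
  have h1 : ∑ r, (e r + 1) ≤ ∑ _r : Fin m, 2 ^ T :=
    Finset.sum_le_sum fun r _ => (he r).le.trans_lt (hx r)
  rw [Finset.sum_add_distrib] at h1
  simp only [Finset.sum_const, Finset.card_univ, Fintype.card_fin, smul_eq_mul, mul_one] at h1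
  have h2 : (m + 1) * 2 ^ T ≤ 2 ^ T * (c + 1) := by
    rw [mul_comm]
    exact Nat.mul_le_mul_left _ (by omega)
  have := Nat.one_le_two_pow (n := T)
  nlinarith

theorem card_carrySet_zero_le (m j : ℕ) : (carrySet m 0 j).card ≤ 1 := by
  rw [Finset.card_le_one]
  intro x hx y hy
  have hx := (mem_carrySet.1 hx).1
  have hy := (mem_carrySet.1 hy).1
  funext r
  have h1 := hx r
  have h2 := hy r
  omega

/-- Strip the leading digits and let `w` be the number of ones among them. The leading digit of the
sum is 1 and the outgoing carry at least `j`, so the incoming carry plus at most `w` is at least `2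
* j + 1`. Truncated subtraction is right here: for large `w` any incoming carry is allowed. -/
theorem card_carrySet_succ_le (m T j : ℕ) :
    (carrySet m (T + 1) j).card ≤
      ∑ w ∈ Finset.range (m + 1), m.choose w * (carrySet m T (2 * j + 1 - w)).card := by
  have hpow := Finset.sum_powerset_apply_card (x := (Finset.univ : Finset (Fin m)))
    (fun w => (carrySet m T (2 * j + 1 - w)).card)
  simp only [Finset.card_univ, Fintype.card_fin, smul_eq_mul] at hpow
  rw [← hpow, ← Finset.card_sigma]
  have hT : 2 ^ (T + 1) = 2 * 2 ^ T := by rw [pow_succ, mul_comm]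
  have hT0 : 0 < 2 ^ T := by positivity
  refine Finset.card_le_card_of_injOn
    (fun x => ⟨Finset.univ.filter fun r => x r / 2 ^ T = 1, fun r => x r % 2 ^ T⟩) ?_ ?_
  · intro x hx
    obtain ⟨hx, e, he, a, c, ha, hc, h⟩ := mem_carrySet.1 hx
    simp only [Finset.coe_sigma, Set.mem_sigma_iff, Finset.mem_coe, Finset.mem_powerset,
      Finset.subset_univ, true_and]
    rw [mem_carrySet]
    refine ⟨fun r => Nat.mod_lt _ hT0, fun r => e r % 2 ^ T, fun r => (he r).mod T, ?_⟩
    have hsplit : ∑ r, e r = 2 ^ T * ∑ r, e r / 2 ^ T + ∑ r, e r % 2 ^ T := by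
      rw [Finset.mul_sum, ← Finset.sum_add_distrib]
      exact Finset.sum_congr rfl fun r _ => (Nat.div_add_mod _ _).symm
    have hcard : ∑ r, e r / 2 ^ T ≤ (Finset.univ.filter fun r => x r / 2 ^ T = 1).card := by
      rw [Finset.card_filter]
      refine Finset.sum_le_sum fun r _ => ?_
      have h1 := ((he r).div T).le
      have h2 : x r / 2 ^ T < 2 := Nat.div_lt_of_lt_mul (by rw [mul_comm, ← hT]; exact hx r)
      split_ifs <;> omega
    set H := ∑ r, e r / 2 ^ T with hH
    rw [hsplit, hT] at h
    generalize 2 ^ T = P at *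
    have hHc : H < 2 * (c + 1) := by
      by_contra hlt
      have := Nat.mul_le_mul_left P (not_lt.1 hlt)
      have h2 : 2 * P * (c + 1) = P * (2 * (c + 1)) := by ring
      omega
    refine ⟨a, 2 * (c + 1) - H - 1, ha, by omega, ?_⟩
    obtain ⟨y, hy⟩ : ∃ y, 2 * (c + 1) = H + y + 1 := ⟨2 * (c + 1) - H - 1, by omega⟩
    have h3 : 2 * (c + 1) - H - 1 + 1 = y + 1 := by omega
    rw [h3]
    have h4 : 2 * P * (c + 1) = P * H + P * (y + 1) := by
      rw [mul_comm 2 P, mul_assoc, hy]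
      ring
    rw [h4] at h
    dsimp only
    omega
  · intro x hx y hy hxy
    have hx' := (mem_carrySet.1 hx).1
    have hy' := (mem_carrySet.1 hy).1
    simp only [Sigma.mk.injEq, heq_eq_eq] at hxy
    funext r
    have h1 := Finset.ext_iff.1 hxy.1 r
    have h2 := congrFun hxy.2 r
    simp only [Finset.mem_filter, Finset.mem_univ, true_and] at h1 h2
    have hx2 : x r / 2 ^ T < 2 := Nat.div_lt_of_lt_mul (by rw [mul_comm, ← hT]; exact hx' r)
    have hy2 : y r / 2 ^ T < 2 := Nat.div_lt_of_lt_mul (by rw [mul_comm, ← hT]; exact hy' r)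
    have h3 : x r / 2 ^ T = y r / 2 ^ T := by
      generalize x r / 2 ^ T = u at *
      generalize y r / 2 ^ T = w at *
      omega
    rw [← Nat.div_add_mod (x r) (2 ^ T), ← Nat.div_add_mod (y r) (2 ^ T), h2, h3]

/-- The matrix reindexed by the number `w` of leading ones. All `w` above `2 * j` fall into column
0; carries of `m` or more contribute nothing, in accordance with `carrySet_eq_empty`. -/
theorem carryMatrix_mulVec {m : ℕ} (v : Fin m → ℝ) (j : Fin m) :
    (carryMatrix m).mulVec v j = ∑ w ∈ Finset.range (m + 1), (m.choose w : ℝ) *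
      if h : 2 * (j : ℕ) + 1 - w < m then v ⟨2 * (j : ℕ) + 1 - w, h⟩ else 0 := by
  have h1 : ∀ w, (if h : 2 * (j : ℕ) + 1 - w < m then v ⟨2 * (j : ℕ) + 1 - w, h⟩ else 0) =
      ∑ c : Fin m, if 2 * (j : ℕ) + 1 - w = c then v c else 0 := by
    intro w
    split_ifs with h
    · rw [Finset.sum_eq_single ⟨2 * (j : ℕ) + 1 - w, h⟩]
      · simp
      · intro c _ hc
        rw [if_neg]
        intro h'
        exact hc (Fin.ext h'.symm)
      · simp
    · symm
      refine Finset.sum_eq_zero fun c _ => if_neg fun h' => h ?_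
      rw [h']
      exact c.2
  simp_rw [h1, Finset.mul_sum]
  rw [Finset.sum_comm]
  change ∑ c, carryMatrix m j c * v c = _
  refine Finset.sum_congr rfl fun c _ => ?_
  simp_rw [mul_ite, mul_zero]
  rw [← Finset.sum_filter, ← Finset.sum_mul]
  congr 1
  simp only [carryMatrix, Matrix.of_apply]
  split_ifs with hc0 hc
  · refine Finset.sum_congr ?_ fun _ _ => rfl
    ext w
    simp only [Finset.mem_Icc, Finset.mem_filter, Finset.mem_range, hc0]
    omega
  · rw [Finset.sum_eq_single (2 * (j : ℕ) + 1 - c)]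
    · intro w hw hne
      rw [Finset.mem_filter] at hw
      omega
    · intro hw
      rw [Finset.mem_filter, Finset.mem_range, not_and'] at hw
      rw [Nat.choose_eq_zero_of_lt (not_le.1 fun h => hw (by omega) (by omega)), Nat.cast_zero]
  · symm
    refine Finset.sum_eq_zero fun w hw => ?_
    rw [Finset.mem_filter] at hw
    omega

/-- Induction on `T` against the supersolution `v`; dividing by its least entry settles `T = 0`. -/
theorem exists_card_carrySet_le {m : ℕ} {t : ℝ} (ht : 0 ≤ t) {v : Fin m → ℝ} (hv : ∀ i, 0 < v i)
    (h : ∀ i, (carryMatrix m).mulVec v i ≤ t * v i) (j : Fin m) :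
    ∃ C : ℝ, 0 < C ∧ ∀ T, ((carrySet m T j).card : ℝ) ≤ C * t ^ T := by
  obtain ⟨i₀, -, hi₀⟩ := Finset.exists_min_image Finset.univ v ⟨j, Finset.mem_univ j⟩
  set C : ℝ := (v i₀)⁻¹ with hC
  have hC0 : 0 < C := inv_pos.2 (hv i₀)
  have key : ∀ T, ∀ j : Fin m, ((carrySet m T j).card : ℝ) ≤ C * t ^ T * v j := by
    intro T
    induction T with
    | zero =>
      intro j
      have h1 : ((carrySet m 0 j).card : ℝ) ≤ 1 := by exact_mod_cast card_carrySet_zero_le m j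
      have h2 : 1 ≤ C * v j := by
        rw [hC, inv_mul_eq_div, one_le_div (hv i₀)]
        exact hi₀ j (Finset.mem_univ j)
      rw [pow_zero, mul_one]
      exact h1.trans h2
    | succ T ih =>
      intro j
      calc ((carrySet m (T + 1) j).card : ℝ)
          ≤ ∑ w ∈ Finset.range (m + 1), (m.choose w : ℝ) *
              ((carrySet m T (2 * j + 1 - w)).card : ℝ) := by
            exact_mod_cast card_carrySet_succ_le m T j
        _ ≤ ∑ w ∈ Finset.range (m + 1), (m.choose w : ℝ) * (C * t ^ T *
              if h : 2 * (j : ℕ) + 1 - w < m then v ⟨2 * (j : ℕ) + 1 - w, h⟩ else 0) := by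
            refine Finset.sum_le_sum fun w _ => mul_le_mul_of_nonneg_left ?_ (Nat.cast_nonneg _)
            split_ifs with hw
            · exact ih ⟨_, hw⟩
            · rw [carrySet_eq_empty (not_lt.1 hw)]
              simp
        _ = C * t ^ T * (carryMatrix m).mulVec v j := by
            rw [carryMatrix_mulVec, Finset.mul_sum]
            exact Finset.sum_congr rfl fun w _ => by ring
        _ ≤ C * t ^ T * (t * v j) := mul_le_mul_of_nonneg_left (h j) (by positivity)
        _ = C * t ^ (T + 1) * v j := by ring
  refine ⟨C * v j, mul_pos hC0 (hv j), fun T => (key T j).trans (le_of_eq (by ring))⟩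

/-! ### Counting bad exponents -/

/-- The exponent vectors of the monomials that violate one of the parity checks along lines. -/
def IsBadExponent {m : ℕ} (q s : ℕ) (d : Fin m → ℕ) : Prop :=
  ∑ r, d r / q < s ∧ ∃ e : Fin m → ℕ, (∀ r, BitLE (e r) (d r)) ∧
    ∃ j < s, ∑ r, e r + j + 1 = s * q

/-- Cut each exponent into `σ` low digits, `T` middle digits and a top part. The low digits are free
and send a carry below `m + 1` into the middle, which then lies in `carrySet`. The sum of the top
parts takes at most `m + 1` values just below `s`, so it and all but one top part determine the
last. -/
theorem card_isBadExponent_le {m σ T : ℕ} (hT : 1 ≤ T)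
    (B : Finset (Fin (m + 1) → ℕ)) (hB : ∀ d ∈ B, IsBadExponent (2 ^ (T + σ)) (2 ^ σ) d) :
    B.card ≤ (2 ^ σ) ^ (m + 1) * (carrySet (m + 1) T 0).card *
      ((2 ^ σ) ^ m * (m + 1)) := by
  set s := 2 ^ σ with hs
  set Q := 2 ^ T with hQ
  have hs0 : 0 < s := by positivity
  have hQ2 : 2 ≤ Q := by
    have := Nat.pow_le_pow_right (n := 2) (by norm_num) hT
    rwa [pow_one] at this
  have hq : 2 ^ (T + σ) = Q * s := pow_add _ _ _
  rw [hq] at hB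
  have hdecomp : ∀ a : ℕ, a = a % s + s * (a / s % Q) + s * Q * (a / (Q * s)) := by
    intro a
    have h1 := Nat.mod_add_div a s
    have h2 := Nat.mod_add_div (a / s) Q
    rw [Nat.div_div_eq_div_mul, mul_comm s Q] at h2
    calc a = a % s + s * (a / s) := h1.symm
      _ = a % s + s * (a / s % Q + Q * (a / (Q * s))) := by rw [h2]
      _ = _ := by ring
  set low : Finset (Fin (m + 1) → ℕ) := Fintype.piFinset fun _ => Finset.range s with hlow
  set top : Finset ((Fin m → ℕ) × ℕ) :=
    (Fintype.piFinset fun _ => Finset.range s) ×ˢ Finset.range (m + 1) with htop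
  have hcard : (low ×ˢ carrySet (m + 1) T 0 ×ˢ top).card =
      s ^ (m + 1) * (carrySet (m + 1) T 0).card * (s ^ m * (m + 1)) := by
    rw [Finset.card_product, Finset.card_product, hlow, htop, Finset.card_product,
      Fintype.card_piFinset, Fintype.card_piFinset]
    simp [mul_assoc]
  have hfact : ∀ d ∈ B, (fun r => d r / s % Q) ∈ carrySet (m + 1) T 0 ∧
      ∑ r, d r / (Q * s) < s ∧ s ≤ ∑ r, d r / (Q * s) + (m + 1) := by
    intro d hd
    obtain ⟨hd1, e, he, j, hj, hsum⟩ := hB d hd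
    set Y := ∑ r, d r / (Q * s) with hY
    have hesum : ∑ r, e r = ∑ r, e r % s + s * ∑ r, e r / s % Q + s * Q * ∑ r, e r / (Q * s) := by
      rw [Finset.mul_sum, Finset.mul_sum, ← Finset.sum_add_distrib, ← Finset.sum_add_distrib]
      exact Finset.sum_congr rfl fun r _ => hdecomp (e r)
    refine ⟨mem_carrySet.2 ⟨fun r => Nat.mod_lt _ (by omega), fun r => e r / s % Q,
      fun r => ((he r).div σ).mod T, ?_⟩, hd1, ?_⟩
    · set lo := ∑ r, e r % s with hlo
      set mid := ∑ r, e r / s % Q with hmid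
      set tp := ∑ r, e r / (Q * s) with htp
      have hlo2 : lo + (m + 1) ≤ (m + 1) * s := by
        have : ∑ r, (e r % s + 1) ≤ ∑ _r : Fin (m + 1), s :=
          Finset.sum_le_sum fun r _ => Nat.mod_lt _ hs0
        rw [Finset.sum_add_distrib] at this
        simpa using this
      have hdvd : s ∣ lo + j + 1 := by
        have h1 : s ∣ (lo + j + 1) + s * (mid + Q * tp) := by
          refine ⟨Q * s, ?_⟩
          rw [hesum] at hsum
          rw [← hsum]
          ring
        exact (Nat.dvd_add_left (dvd_mul_right _ _)).1 h1
      obtain ⟨y, hy⟩ := hdvd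
      have hy0 : y ≠ 0 := by
        rintro rfl
        omega
      obtain ⟨a, rfl⟩ := Nat.exists_eq_succ_of_ne_zero hy0
      have ha : a < m + 1 := by
        by_contra hlt
        have h1 := Nat.mul_le_mul_left s (not_lt.1 hlt)
        have h2 : s * (a + 1) = s * a + s := by ring
        rw [Nat.succ_eq_add_one, h2] at hy
        rw [mul_comm (m + 1) s] at hlo2
        omega
      have hmain : mid + a + 1 + Q * tp = Q * s := by
        have h1 : s * (mid + a + 1 + Q * tp) = s * (Q * s) := by
          rw [← hsum, hesum]
          rw [Nat.succ_eq_add_one] at hy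
          calc s * (mid + a + 1 + Q * tp) = s * (a + 1) + s * mid + s * Q * tp := by ring
            _ = _ := by rw [← hy]; ring
        exact Nat.eq_of_mul_eq_mul_left hs0 h1
      have htps : tp < s := by
        by_contra hlt
        have := Nat.mul_le_mul_left Q (not_lt.1 hlt)
        omega
      obtain ⟨c, hc⟩ : ∃ c, s = tp + c + 1 := ⟨s - tp - 1, by omega⟩
      refine ⟨a, c, ha, Nat.zero_le _, ?_⟩
      have h3 : Q * s = Q * tp + Q * (c + 1) := by
        rw [hc]
        ring
      rw [← hQ]
      omega
    · have h1 : ∑ r, e r ≤ ∑ r, d r := Finset.sum_le_sum fun r _ => (he r).le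
      have h2 : ∑ r, (d r + 1) ≤ ∑ r, (Q * s) * (d r / (Q * s) + 1) := by
        refine Finset.sum_le_sum fun r _ => ?_
        have h3 := Nat.mod_add_div (d r) (Q * s)
        have h4 := Nat.mod_lt (d r) (show 0 < Q * s by positivity)
        rw [mul_add, mul_one]
        omega
      rw [← Finset.mul_sum, Finset.sum_add_distrib, Finset.sum_add_distrib] at h2
      simp only [Finset.sum_const, Finset.card_univ, Fintype.card_fin, smul_eq_mul, mul_one] at h2
      rw [← hY] at h2
      by_contra hlt
      have h5 : Y + (m + 1) + 1 ≤ s := by omega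
      have h6 := Nat.mul_le_mul_left (Q * s) h5
      have h7 : Q * s * (Y + (m + 1) + 1) = Q * s * (Y + (m + 1)) + Q * s := by ring
      have h8 : s * (Q * s) = Q * s * s := by ring
      have h9 := Nat.mul_le_mul_right s hQ2
      omega
  rw [← hcard]
  refine Finset.card_le_card_of_injOn (fun d => (fun r => d r % s, fun r => d r / s % Q,
    fun r => d r.succ / (Q * s), ∑ r, d r / (Q * s) + (m + 1) - s)) ?_ ?_
  · intro d hd
    obtain ⟨h1, h2, h3⟩ := hfact d hd
    simp only [Finset.coe_product, Set.mem_prod, Finset.mem_coe, hlow, htop, Fintype.mem_piFinset,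
      Finset.mem_range]
    refine ⟨fun r => Nat.mod_lt _ hs0, h1, fun r => lt_of_le_of_lt ?_ h2, by omega⟩
    exact Finset.single_le_sum (f := fun r => d r / (Q * s)) (fun _ _ => Nat.zero_le _)
      (Finset.mem_univ r.succ)
  · intro d hd d' hd' hdd
    obtain ⟨-, -, h3⟩ := hfact d hd
    obtain ⟨-, -, h3'⟩ := hfact d' hd'
    simp only [Prod.mk.injEq] at hdd
    obtain ⟨e1, e2, e3, e4⟩ := hdd
    have hsucc : ∀ r : Fin m, d r.succ / (Q * s) = d' r.succ / (Q * s) := fun r => congrFun e3 r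
    have hzero : d 0 / (Q * s) = d' 0 / (Q * s) := by
      have h4 : ∑ r, d r / (Q * s) = ∑ r, d' r / (Q * s) := by omega
      rw [Fin.sum_univ_succ, Fin.sum_univ_succ, Finset.sum_congr rfl fun r _ => hsucc r] at h4
      omega
    funext r
    rw [hdecomp (d r), hdecomp (d' r), congrFun e1 r, congrFun e2 r]
    congr 2
    refine Fin.cases hzero hsucc r

/-! ### Coefficients of products and power sums over a finite field -/

open Polynomial in
theorem coeff_prod_univ {R : Type*} [CommRing R] {m s w : ℕ} (hw : w < s) (Q : Fin m → R[X]) :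
    (∏ r, Q r).coeff w = ∑ i ∈ (Fintype.piFinset fun _ : Fin m => Finset.range s) with
      ∑ r, i r = w, ∏ r, (Q r).coeff (i r) := by
  set N := s + ∑ r, (Q r).natDegree + 1 with hN
  have hQ : ∀ r, Q r = ∑ k ∈ Finset.range N, C ((Q r).coeff k) * X ^ k := by
    intro r
    refine (Q r).as_sum_range_C_mul_X_pow' ?_
    have := Finset.single_le_sum (f := fun r => (Q r).natDegree) (fun _ _ => Nat.zero_le _)
      (Finset.mem_univ r)
    omega
  have hprod : ∏ r, Q r = ∑ i ∈ Fintype.piFinset fun _ : Fin m => Finset.range N,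
      C (∏ r, (Q r).coeff (i r)) * X ^ (∑ r, i r) := by
    rw [Finset.prod_congr rfl fun r _ => hQ r, Finset.prod_univ_sum]
    refine Finset.sum_congr rfl fun i _ => ?_
    rw [Finset.prod_mul_distrib, Finset.prod_pow_eq_pow_sum, map_prod]
  rw [hprod, finsetSum_coeff]
  simp_rw [coeff_C_mul_X_pow]
  rw [← Finset.sum_filter]
  refine Finset.sum_congr ?_ fun _ _ => rfl
  ext i
  simp only [Finset.mem_filter, Fintype.mem_piFinset, Finset.mem_range]
  constructor
  · rintro ⟨-, h⟩
    refine ⟨fun r => ?_, h.symm⟩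
    have := Finset.single_le_sum (f := i) (fun _ _ => Nat.zero_le _) (Finset.mem_univ r)
    omega
  · rintro ⟨h, h'⟩
    exact ⟨fun r => (h r).trans_le (by omega), h'.symm⟩

section FiniteField

variable {K : Type*} [Field K] [Fintype K]

theorem dvd_of_sum_pow_ne_zero {i : ℕ} (h : ∑ x : K, x ^ i ≠ 0) :
    0 < i ∧ Fintype.card K - 1 ∣ i := by
  classical
  have hi : 0 < i := by
    rw [Nat.pos_iff_ne_zero]
    rintro rfl
    simp at h
  refine ⟨hi, ?_⟩
  by_contra hdvd
  refine h ?_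
  have h1 := FiniteField.sum_pow_units K i
  rw [if_neg hdvd] at h1
  rw [← h1, ← Finset.sum_sdiff (Finset.subset_univ {(0 : K)}), Finset.sum_singleton,
    zero_pow hi.ne', add_zero]
  symm
  refine Finset.sum_bij (fun u _ => (u : K)) ?_ ?_ ?_ ?_
  · simp
  · intro a _ b _ hab
    exact Units.ext hab
  · intro b hb
    have hb0 : b ≠ 0 := by simpa using hb
    exact ⟨Units.mk0 b hb0, Finset.mem_univ _, rfl⟩
  · simp

open Polynomial in
theorem exists_coeff_ne_zero_of_sum_taylor_coeff_ne_zero {h : K[X]} {n : ℕ}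
    (hne : ∑ t : K, (taylor t h).coeff n ≠ 0) :
    ∃ e, h.coeff e ≠ 0 ∧ (e.choose n : K) ≠ 0 ∧ n < e ∧ Fintype.card K - 1 ∣ e - n := by
  have h1 : ∀ t : K, (taylor t h).coeff n =
      ∑ e ∈ h.support, (e.choose n : K) * h.coeff e * t ^ (e - n) := by
    intro t
    rw [taylor_coeff, hasseDeriv_apply, Polynomial.sum, eval_finsetSum]
    exact Finset.sum_congr rfl fun e _ => eval_monomial
  simp_rw [h1] at hne
  rw [Finset.sum_comm] at hne
  simp_rw [← Finset.mul_sum] at hne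
  obtain ⟨e, -, he⟩ := Finset.exists_ne_zero_of_sum_ne_zero hne
  obtain ⟨h2, h3⟩ := ne_zero_and_ne_zero_of_mul he
  obtain ⟨h4, h5⟩ := ne_zero_and_ne_zero_of_mul h2
  obtain ⟨h6, h7⟩ := dvd_of_sum_pow_ne_zero h3
  exact ⟨e, h5, h4, by omega, h7⟩

end FiniteField

/-! ### Jets and parity checks along lines -/

/-- The multi-indices of order less than `s`. -/
def jetIndex (m s : ℕ) : Finset (Fin m → ℕ) :=
  (Fintype.piFinset fun _ => Finset.range s).filter fun i => ∑ r, i r < s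

theorem mem_jetIndex {m s : ℕ} {i : Fin m → ℕ} : i ∈ jetIndex m s ↔ ∑ r, i r < s := by
  simp only [jetIndex, Finset.mem_filter, Fintype.mem_piFinset, Finset.mem_range,
    and_iff_right_iff_imp]
  intro h r
  exact (Finset.single_le_sum (fun _ _ => Nat.zero_le _) (Finset.mem_univ r)).trans_lt h

section Jets

open Polynomial

variable {K : Type*} [Field K] {m s : ℕ}

/-- The Taylor coefficients of order less than `s`, at all points, of the product of the
univariate polynomials `P r` in the variables `x r`. -/
noncomputable def prodJet (s : ℕ) (P : Fin m → K[X]) : (Fin m → K) × jetIndex m s → K :=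
  fun x => ∏ r, (taylor (x.1 r) (P r)).coeff (x.2.1 r)

/-- The restriction to the line through `p` in direction `b` of a truncated Taylor expansion. -/
noncomputable def lineJet (b : Fin m → K) (g : jetIndex m s → K) : K[X] :=
  ∑ i, C (g i * ∏ r, b r ^ i.1 r) * X ^ (∑ r, i.1 r)

theorem lineJet_coeff (b : Fin m → K) (g : jetIndex m s → K) (w : ℕ) :
    (lineJet b g).coeff w = ∑ i with ∑ r, i.1 r = w, g i * ∏ r, b r ^ i.1 r := by
  rw [lineJet, finsetSum_coeff, Finset.sum_filter]
  simp_rw [coeff_C_mul_X_pow, eq_comm]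

theorem lineJet_prodJet_coeff (P : Fin m → K[X]) (p b : Fin m → K) {w : ℕ} (hw : w < s) :
    (lineJet b fun i => prodJet s P (p, i)).coeff w =
      (∏ r, (taylor (p r) (P r)).comp (C (b r) * X)).coeff w := by
  rw [lineJet_coeff, coeff_prod_univ hw]
  simp only [prodJet, comp_C_mul_X_coeff, ← Finset.prod_mul_distrib]
  refine Finset.sum_bij' (fun i _ => i.1) (fun i hi => ⟨i, ?_⟩) ?_ ?_ ?_ ?_ ?_
  · rw [mem_jetIndex, (Finset.mem_filter.1 hi).2]
    exact hw
  · intro i hi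
    rw [Finset.mem_filter] at hi ⊢
    refine ⟨?_, hi.2⟩
    exact (Finset.mem_filter.1 i.2).1
  · intro i hi
    exact Finset.mem_filter.2 ⟨Finset.mem_univ _, (Finset.mem_filter.1 hi).2⟩
  · intros; rfl
  · intros; rfl
  · intros; rfl

variable [Fintype K]

/-- The `j`-th parity check along the line through `a` in direction `b`. -/
noncomputable def lineCheck (a b : Fin m → K) (j : ℕ) :
    ((Fin m → K) × jetIndex m s → K) →ₗ[K] K where
  toFun f := ∑ t : K, (lineJet b (fun i => f (a + t • b, i)) * (X + C t) ^ j).coeff (s - 1)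
  map_add' f g := by
    simp only [lineJet, Pi.add_apply, add_mul, map_add, Finset.sum_add_distrib, coeff_add]
  map_smul' c f := by
    simp only [lineJet, Pi.smul_apply, smul_eq_mul, RingHom.id_apply, Finset.mul_sum,
      Finset.sum_mul, mul_assoc, map_mul, finsetSum_coeff, coeff_C_mul]

theorem lineCheck_apply (a b : Fin m → K) (j : ℕ) (f : (Fin m → K) × jetIndex m s → K) :
    lineCheck a b j f =
      ∑ t : K, (lineJet b (fun i => f (a + t • b, i)) * (X + C t) ^ j).coeff (s - 1) := rfl

/-- The factor `(X + C t) ^ j` is the expansion at `t` of the `j`-th power of the line parameter, so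
the check sums Taylor coefficients of one univariate polynomial over all `t`. -/
theorem lineCheck_prodJet (hs : 0 < s) (a b : Fin m → K) (j : ℕ) (P : Fin m → K[X]) :
    lineCheck a b j (prodJet s P) = ∑ t : K,
      (taylor t ((∏ r, (P r).comp (C (a r) + C (b r) * X)) * X ^ j)).coeff (s - 1) := by
  rw [lineCheck_apply]
  refine Finset.sum_congr rfl fun t _ => ?_
  rw [taylor_mul, taylor_X_pow, coeff_mul, coeff_mul]
  refine Finset.sum_congr rfl fun w hw => ?_
  have hw' : w.1 < s := by
    have := Finset.HasAntidiagonal.mem_antidiagonal.1 hw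
    omega
  rw [lineJet_prodJet_coeff P _ b hw']
  congr 2
  change _ = taylorAlgHom t _
  rw [map_prod]
  refine Finset.prod_congr rfl fun r _ => ?_
  change _ = taylor t _
  rw [taylor_apply, taylor_apply, comp_assoc, comp_assoc]
  congr 1
  simp only [add_comp, X_comp, C_comp, mul_comp, Pi.add_apply, Pi.smul_apply, smul_eq_mul, map_add,
    map_mul]
  ring

theorem isBadExponent_of_lineCheck_ne_zero [CharP K 2] {σ T : ℕ} (hT : 1 ≤ T)
    (hK : Fintype.card K = 2 ^ (T + σ)) (hm0 : 0 < m) (hm : m ≤ 2 ^ σ) {a b : Fin m → K} {j : ℕ}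
    (hj : j < 2 ^ σ) {d : Fin m → ℕ} (hd : ∑ r, d r / 2 ^ (T + σ) < 2 ^ σ)
    (hne : lineCheck a b j (prodJet (2 ^ σ) fun r => (X : K[X]) ^ d r) ≠ 0) :
    IsBadExponent (2 ^ (T + σ)) (2 ^ σ) d := by
  have hs0 : 0 < 2 ^ σ := by positivity
  have hodd : ∀ {x y : ℕ}, (x.choose y : K) ≠ 0 → BitLE y x := by
    intro x y h
    refine bitLE_of_odd_choose ?_
    rwa [Ne, CharP.cast_eq_zero_iff K 2, ← even_iff_two_dvd, Nat.not_even_iff_odd] at h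
  rw [lineCheck_prodJet hs0] at hne
  obtain ⟨e₀, he₀, hch, hlt, hdvd⟩ := exists_coeff_ne_zero_of_sum_taylor_coeff_ne_zero hne
  rw [coeff_mul_X_pow'] at he₀
  split_ifs at he₀ with hje
  swap
  · exact absurd rfl he₀
  rw [coeff_prod_univ (Nat.lt_succ_self _)] at he₀
  obtain ⟨e, he, hprod⟩ := Finset.exists_ne_zero_of_sum_ne_zero he₀
  have hesum := (Finset.mem_filter.1 he).2
  have hle : ∀ r, BitLE (e r) (d r) := by
    intro r
    have h1 := Finset.prod_ne_zero_iff.1 hprod r (Finset.mem_univ r)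
    refine hodd fun h0 => h1 ?_
    rw [X_pow_comp]
    have h2 : (C (a r) + C (b r) * X) ^ d r = ((X + C (a r)) ^ d r).comp (C (b r) * X) := by
      rw [pow_comp, add_comp, X_comp, C_comp, add_comm]
    rw [h2, comp_C_mul_X_coeff, coeff_X_add_C_pow, h0, mul_zero, zero_mul]
  refine ⟨hd, e, hle, j, hj, ?_⟩
  -- All `σ` digits of `2 ^ σ - 1` are 1, and by Lucas they reappear in `e₀`.
  have hmod : e₀ % 2 ^ σ = 2 ^ σ - 1 := by
    have h1 := ((hodd hch).mod σ).le
    rw [Nat.mod_eq_of_lt (by omega)] at h1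
    have h2 := Nat.mod_lt e₀ hs0
    omega
  rw [hK] at hdvd
  have hcop : Nat.Coprime (2 ^ (T + σ) - 1) (2 ^ σ) := by
    refine Nat.Coprime.pow_right _ (Nat.coprime_two_right.2 ?_)
    refine Nat.Even.sub_odd Nat.one_le_two_pow ?_ odd_one
    exact (even_two).pow_of_ne_zero (by omega)
  have hsum : ∑ r, e r ≤ ∑ r, d r := Finset.sum_le_sum fun r _ => (hle r).le
  have hq : 2 * 2 ^ σ ≤ 2 ^ (T + σ) := by
    rw [← pow_succ']
    exact Nat.pow_le_pow_right (by norm_num) (by omega)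
  generalize 2 ^ σ = s at *
  generalize 2 ^ (T + σ) = q at *
  set y := e₀ / s with hy
  have he₀eq : e₀ = s * y + (s - 1) := by
    rw [← hmod, hy]
    exact (Nat.div_add_mod _ _).symm
  have h3 : e₀ - (s - 1) = s * y := by omega
  rw [h3] at hdvd
  obtain ⟨z, hz⟩ := hcop.dvd_of_dvd_mul_left hdvd
  have hbound : ∑ r, d r + m ≤ q * (s - 1) + q * m := by
    have h4 : ∑ r, (d r + 1) ≤ ∑ r, q * (d r / q + 1) := by
      refine Finset.sum_le_sum fun r _ => ?_
      have h5 := Nat.mod_add_div (d r) q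
      have h6 := Nat.mod_lt (d r) (show 0 < q by omega)
      rw [mul_add, mul_one]
      omega
    rw [← Finset.mul_sum, Finset.sum_add_distrib, Finset.sum_add_distrib] at h4
    simp only [Finset.sum_const, Finset.card_univ, Fintype.card_fin, smul_eq_mul, mul_one] at h4
    refine h4.trans ?_
    rw [← mul_add]
    exact Nat.mul_le_mul_left _ (by omega)
  -- The degree bound, with `m ≤ s` and `2 * s ≤ q`, excludes `z ≥ 2`; hence `e₀ = s * q - 1`.
  have hz1 : z = 1 := by
    have hz0 : z ≠ 0 := by
      rintro rfl
      rw [mul_zero] at hz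
      rw [hz, mul_zero] at he₀eq
      omega
    have hz2 : z < 2 := by
      by_contra hz2
      have h7 : (q - 1) * 2 ≤ y := hz ▸ Nat.mul_le_mul_left _ (not_lt.1 hz2)
      have h8 := Nat.mul_le_mul_left s h7
      have h9 := Nat.mul_le_mul_left q hm
      obtain ⟨q', rfl⟩ : ∃ q', q = q' + 1 := ⟨q - 1, by omega⟩
      obtain ⟨s', rfl⟩ : ∃ s', s = s' + 1 := ⟨s - 1, by omega⟩
      simp only [Nat.add_sub_cancel] at h8 hbound he₀eq
      have h10 : (q' + 1) * m = q' * m + m := by ring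
      have h11 : (s' + 1) * (q' * 2) ≤ (q' + 1) * s' + q' * m := by omega
      have h12 := Nat.mul_le_mul_left q' hm
      nlinarith
    omega
  rw [hz1, mul_one] at hz
  have h14 : s * q = s * y + s := by
    rw [hz, Nat.mul_sub, mul_one, Nat.sub_add_cancel]
    exact Nat.le_mul_of_pos_right _ (by omega)
  omega

end Jets

/-! ### Jets of reduced monomials span all words -/

/-- A family of vectors that is triangular, with respect to a rank function, in the standard basis
of a space of functions lies in no proper subspace. -/
theorem submodule_eq_top_of_triangular {K X : Type*} [Field K] [Fintype X] [DecidableEq X]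
    (S : Submodule K (X → K)) (rk : X → ℕ) (V : X → X → K) (hV : ∀ x, V x ∈ S)
    (hdiag : ∀ x, V x x ≠ 0) (htri : ∀ x y, V x y ≠ 0 → y = x ∨ rk x < rk y) : S = ⊤ := by
  set M := ∑ x, rk x with hM
  have hrk : ∀ x, rk x ≤ M := fun x =>
    Finset.single_le_sum (fun _ _ => Nat.zero_le _) (Finset.mem_univ x)
  have key : ∀ n x, M - rk x = n → (Pi.single x (1 : K) : X → K) ∈ S := by
    intro n
    induction n using Nat.strong_induction_on with
    | _ n ih =>
      intro x hx
      have h1 : V x = V x x • Pi.single x 1 +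
          ∑ y ∈ Finset.univ.filter (fun y => rk x < rk y), V x y • Pi.single y (1 : K) := by
        funext z
        rw [Pi.add_apply, Finset.sum_apply]
        simp only [Pi.smul_apply, smul_eq_mul, Pi.single_apply, mul_ite, mul_one, mul_zero]
        rw [Finset.sum_ite_eq]
        by_cases hzx : z = x
        · subst hzx
          simp
        · rw [if_neg hzx, zero_add]
          by_cases hz : V x z = 0
          · simp [hz]
          · have hlt := (htri x z hz).resolve_left hzx
            rw [if_pos (by simpa using hlt)]
      have h2 : ∑ y ∈ Finset.univ.filter (fun y => rk x < rk y), V x y • Pi.single y (1 : K) ∈ S := by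
        refine Submodule.sum_mem _ fun y hy => S.smul_mem _ ?_
        have hy' := (Finset.mem_filter.1 hy).2
        have := hrk y
        exact ih (M - rk y) (by omega) y rfl
      have h3 : V x x • Pi.single x (1 : K) ∈ S := by
        rw [eq_sub_of_add_eq h1.symm]
        exact S.sub_mem (hV x) h2
      exact (S.smul_mem_iff (hdiag x)).1 h3
  rw [eq_top_iff, ← (Pi.basisFun K X).span_eq, Submodule.span_le]
  rintro _ ⟨x, rfl⟩
  rw [Pi.basisFun_apply]
  exact key _ x rfl

section Spanning

open Polynomial

variable {K : Type*} [Field K] {m s : ℕ}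

/-- The exponent vectors `d` with `∑ r, d r / q < s`. -/
def reducedExponents (m q s : ℕ) : Finset (Fin m → ℕ) :=
  (Fintype.piFinset fun _ => Finset.range (q * s)).filter fun d => ∑ r, d r / q < s

theorem prodJet_mem_span_of_natDegree_lt {P : Fin m → K[X]} {q : ℕ} {i : Fin m → ℕ}
    (hi : ∑ r, i r < s) (hP : ∀ r, (P r).natDegree < q * (i r + 1)) :
    prodJet s P ∈ Submodule.span K
      ((fun d => prodJet s fun r => (X : K[X]) ^ d r) '' (reducedExponents m q s : Set (Fin m → ℕ))) := by
  have h1 : prodJet s P = ∑ d ∈ Fintype.piFinset fun r => Finset.range (q * (i r + 1)),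
      (∏ r, (P r).coeff (d r)) • prodJet s fun r => (X : K[X]) ^ d r := by
    funext x
    rw [Finset.sum_apply]
    simp only [prodJet, Pi.smul_apply, smul_eq_mul, ← Finset.prod_mul_distrib]
    rw [← Finset.prod_univ_sum (fun r => Finset.range (q * (i r + 1)))
      (fun r k => (P r).coeff k * (taylor (x.1 r) ((X : K[X]) ^ k)).coeff (x.2.1 r))]
    refine Finset.prod_congr rfl fun r _ => ?_
    conv_lhs => rw [(P r).as_sum_range_C_mul_X_pow' (hP r)]
    rw [map_sum, finsetSum_coeff]
    refine Finset.sum_congr rfl fun k _ => ?_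
    rw [taylor_mul, taylor_C, coeff_C_mul]
  rw [h1]
  refine Submodule.sum_mem _ fun d hd => Submodule.smul_mem _ _ (Submodule.subset_span ⟨d, ?_, rfl⟩)
  have hd' : ∀ r, d r < q * (i r + 1) := fun r => Finset.mem_range.1 (Fintype.mem_piFinset.1 hd r)
  have hir : ∀ r, i r < s := fun r =>
    (Finset.single_le_sum (fun _ _ => Nat.zero_le _) (Finset.mem_univ r)).trans_lt hi
  simp only [reducedExponents, Finset.coe_filter, Set.mem_ofPred_eq, Fintype.mem_piFinset,
    Finset.mem_range]
  refine ⟨fun r => (hd' r).trans_le (Nat.mul_le_mul_left _ (hir r)), lt_of_le_of_lt ?_ hi⟩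
  exact Finset.sum_le_sum fun r _ => Nat.lt_succ_iff.1 (Nat.div_lt_of_lt_mul (hd' r))

variable [Fintype K]

/-- A univariate polynomial whose Taylor expansion starts at `p` with a multiple of `X ^ i` and
vanishes to order more than `i` at all other points. -/
noncomputable def bumpPolynomial (p : K) (i : ℕ) : K[X] :=
  (1 - (X - C p) ^ (Fintype.card K - 1)) * (X ^ Fintype.card K - X) ^ i

theorem natDegree_bumpPolynomial_lt (p : K) (i : ℕ) :
    (bumpPolynomial p i).natDegree < Fintype.card K * (i + 1) := by
  have hq := Fintype.one_lt_card (α := K)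
  have h1 : (1 - (X - C p) ^ (Fintype.card K - 1) : K[X]).natDegree ≤ Fintype.card K - 1 := by
    compute_degree
  have h2 : (X ^ Fintype.card K - X : K[X]).natDegree ≤ Fintype.card K := by
    refine (natDegree_sub_le _ _).trans ?_
    rw [natDegree_X_pow, natDegree_X]
    exact max_le le_rfl hq.le
  have h3 : ((X ^ Fintype.card K - X : K[X]) ^ i).natDegree ≤ i * Fintype.card K :=
    natDegree_pow_le.trans (Nat.mul_le_mul_left _ h2)
  have h4 := natDegree_mul_le (p := (1 - (X - C p) ^ (Fintype.card K - 1) : K[X]))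
    (q := (X ^ Fintype.card K - X) ^ i)
  rw [bumpPolynomial, mul_add, mul_one, mul_comm]
  rw [mul_comm] at h4
  rw [mul_comm (Fintype.card K) i]
  omega

/-- By Frobenius, `X ^ q - X` is invariant under translation and has a simple zero at every point.
-/
theorem taylor_bumpPolynomial (p p' : K) (i : ℕ) :
    taylor p' (bumpPolynomial p i) =
      ((1 - (X + C (p' - p)) ^ (Fintype.card K - 1)) * (X ^ (Fintype.card K - 1) - 1) ^ i) *
        X ^ i := by
  have hq := Fintype.one_lt_card (α := K)
  have h1 : (X + C p' : K[X]) ^ Fintype.card K = X ^ Fintype.card K + C p' := by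
    obtain ⟨p, hp⟩ := CharP.exists K
    obtain ⟨n, hprime, hn⟩ := FiniteField.card K p
    have : Fact p.Prime := ⟨hprime⟩
    rw [hn, add_pow_char_pow, ← hn, ← C_pow, FiniteField.pow_card]
  have h2 : (X ^ Fintype.card K - X : K[X]) = (X ^ (Fintype.card K - 1) - 1) * X := by
    rw [sub_mul, one_mul, ← pow_succ, Nat.sub_add_cancel hq.le]
  rw [bumpPolynomial, taylor_mul, map_sub, taylor_pow, taylor_pow, map_sub, map_sub, taylor_X_pow,
    taylor_X, taylor_one, taylor_C, h1, add_sub_add_right_eq_sub, h2, mul_pow, map_one, map_sub]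
  ring

theorem taylor_bumpPolynomial_coeff_of_lt {p p' : K} {i w : ℕ} (h : w < i) :
    (taylor p' (bumpPolynomial p i)).coeff w = 0 := by
  rw [taylor_bumpPolynomial, coeff_mul_X_pow', if_neg (not_le.2 h)]

theorem taylor_bumpPolynomial_coeff_self {p p' : K} {i : ℕ} :
    (taylor p' (bumpPolynomial p i)).coeff i ≠ 0 ↔ p' = p := by
  have hq := Fintype.one_lt_card (α := K)
  have hq1 : Fintype.card K - 1 ≠ 0 := by omega
  rw [taylor_bumpPolynomial, coeff_mul_X_pow', if_pos le_rfl, Nat.sub_self, coeff_zero_eq_eval_zero]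
  simp only [eval_mul, eval_sub, eval_one, eval_pow, eval_add, eval_X, eval_C, zero_add,
    zero_pow hq1, zero_sub]
  have h1 : ((-1 : K)) ^ i ≠ 0 := pow_ne_zero _ (neg_ne_zero.2 one_ne_zero)
  rw [mul_ne_zero_iff_right h1]
  constructor
  · intro h
    by_contra hne
    exact h (by rw [FiniteField.pow_card_sub_one_eq_one _ (sub_ne_zero.2 hne), sub_self])
  · rintro rfl
    rw [sub_self, zero_pow hq1, sub_zero]
    exact one_ne_zero

/-- Products of bump polynomials are triangular with respect to total order, and their degrees keep
them in the span of the reduced monomials. -/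
theorem span_prodJet_eq_top :
    Submodule.span K ((fun d => prodJet s fun r => (X : K[X]) ^ d r) ''
      (reducedExponents m (Fintype.card K) s : Set (Fin m → ℕ))) = ⊤ := by
  classical
  refine submodule_eq_top_of_triangular _ (fun x => ∑ r, x.2.1 r)
    (fun x => prodJet s fun r => bumpPolynomial (x.1 r) (x.2.1 r)) ?_ ?_ ?_
  · intro x
    exact prodJet_mem_span_of_natDegree_lt (mem_jetIndex.1 x.2.2)
      fun r => natDegree_bumpPolynomial_lt _ _
  · intro x
    exact Finset.prod_ne_zero_iff.2 fun r _ => taylor_bumpPolynomial_coeff_self.2 rfl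
  · intro x y hxy
    have h1 : ∀ r, (taylor (y.1 r) (bumpPolynomial (x.1 r) (x.2.1 r))).coeff (y.2.1 r) ≠ 0 :=
      fun r => Finset.prod_ne_zero_iff.1 hxy r (Finset.mem_univ r)
    have hle : ∀ r, x.2.1 r ≤ y.2.1 r := fun r =>
      not_lt.1 fun hlt => h1 r (taylor_bumpPolynomial_coeff_of_lt hlt)
    rcases (Finset.sum_le_sum fun r (_ : r ∈ Finset.univ) => hle r).lt_or_eq with hlt | heq
    · exact Or.inr hlt
    · left
      have h2 := (Finset.sum_eq_sum_iff_of_le fun r (_ : r ∈ Finset.univ) => hle r).1 heq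
      refine Prod.ext (funext fun r => ?_) (Subtype.ext (funext fun r => ?_))
      · have h3 := h1 r
        rw [← h2 r (Finset.mem_univ r)] at h3
        exact taylor_bumpPolynomial_coeff_self.1 h3
      · exact (h2 r (Finset.mem_univ r)).symm

end Spanning

/-! ### Recovering a jet from lines -/

section Grid

variable {K : Type*} [Field K] {m s : ℕ}

/-- Setting the first variable to 1 loses nothing in a homogeneous part, whose degree `w` fixes the
first exponent. The resulting polynomial has degree below `s` in each variable and vanishes on a
grid of side `s`. -/
theorem eq_zero_of_forall_grid {g : jetIndex (m + 1) s → K} (S : Fin m → Finset K)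
    (hS : ∀ r, s ≤ (S r).card)
    (h : ∀ b : Fin m → K, (∀ r, b r ∈ S r) → ∀ w < s,
      ∑ i : jetIndex (m + 1) s with ∑ r, i.1 r = w,
        g i * ∏ r, (Fin.cons 1 b : Fin (m + 1) → K) r ^ i.1 r = 0) (i : jetIndex (m + 1) s) :
    g i = 0 := by
  classical
  set w := ∑ r, i.1 r with hw
  have hws : w < s := mem_jetIndex.1 i.2
  set I : Finset (jetIndex (m + 1) s) := Finset.univ.filter fun i => ∑ r, i.1 r = w with hI
  have hiI : i ∈ I := by
    rw [hI, Finset.mem_filter]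
    exact ⟨Finset.mem_univ _, hw.symm⟩
  set e : jetIndex (m + 1) s → (Fin m →₀ ℕ) :=
    fun i => Finsupp.equivFunOnFinite.symm (Fin.tail i.1) with he
  set P : MvPolynomial (Fin m) K := ∑ i ∈ I, MvPolynomial.monomial (e i) (g i) with hP
  have hinj : ∀ x ∈ I, ∀ y ∈ I, e x = e y → x = y := by
    intro x hx y hy hxy
    have hx' := (Finset.mem_filter.1 hx).2
    have hy' := (Finset.mem_filter.1 hy).2
    have ht : Fin.tail x.1 = Fin.tail y.1 := Finsupp.equivFunOnFinite.symm.injective hxy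
    have hts : ∀ r : Fin m, x.1 r.succ = y.1 r.succ := fun r => congrFun ht r
    rw [Fin.sum_univ_succ, Finset.sum_congr rfl fun r _ => hts r] at hx'
    rw [Fin.sum_univ_succ] at hy'
    refine Subtype.ext (funext fun r => Fin.cases (by omega) hts r)
  have hP0 : P = 0 := by
    refine MvPolynomial.eq_zero_of_eval_zero_at_prod_finset P S (fun r => ?_) fun b hb => ?_
    · refine lt_of_lt_of_le (lt_of_le_of_lt ?_ hws) (hS r)
      rw [hP]
      refine (MvPolynomial.degreeOf_sum_le _ _ _).trans (Finset.sup_le fun x hx => ?_)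
      refine (MvPolynomial.degreeOf_le_iff.2 ?_)
      intro y hy
      have := MvPolynomial.support_monomial_subset hy
      rw [Finset.mem_singleton] at this
      rw [this, ← (Finset.mem_filter.1 hx).2]
      exact Finset.single_le_sum (f := fun r => x.1 r) (fun _ _ => Nat.zero_le _)
        (Finset.mem_univ r.succ)
    · rw [hP, map_sum, ← h b hb w hws]
      refine Finset.sum_congr rfl fun x _ => ?_
      rw [MvPolynomial.eval_monomial, Fin.prod_univ_succ, Fin.cons_zero, one_pow, one_mul,
        Finsupp.prod_fintype _ _ fun _ => pow_zero _]
      rfl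
  have hc : P.coeff (e i) = g i := by
    rw [hP, MvPolynomial.coeff_sum, Finset.sum_eq_single i]
    · rw [MvPolynomial.coeff_monomial, if_pos rfl]
    · intro x hx hxi
      rw [MvPolynomial.coeff_monomial, if_neg]
      intro h'
      exact hxi (hinj x hx i hiI h')
    · intro hi
      exact absurd hiI hi
  rw [← hc, hP0, MvPolynomial.coeff_zero]

end Grid

section Recovery

open Polynomial

variable {K : Type*} [Field K] [Fintype K] {m s : ℕ}

/-- Only `t = 0` survives in the check, and the choice `j = s - 1 - w` reads off the coefficient of
degree `w`. -/
theorem sum_eq_zero_of_lineCheck_eq_zero {a b : Fin m → K} {f : (Fin m → K) × jetIndex m s → K}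
    (hcheck : ∀ j < s, lineCheck a b j f = 0) (hf : ∀ t : K, t ≠ 0 → ∀ i, f (a + t • b, i) = 0)
    {w : ℕ} (hw : w < s) :
    ∑ i : jetIndex m s with ∑ r, i.1 r = w, f (a, i) * ∏ r, b r ^ i.1 r = 0 := by
  have h := hcheck (s - 1 - w) (by omega)
  rw [lineCheck_apply, Finset.sum_eq_single 0] at h
  · rw [map_zero, add_zero, coeff_mul_X_pow', if_pos (by omega),
      show s - 1 - (s - 1 - w) = w by omega, lineJet_coeff] at h
    simpa using h
  · intro t _ ht
    have h1 : lineJet b (fun i => f (a + t • b, i)) = 0 := by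
      simp [lineJet, hf t ht]
    rw [h1, zero_mul, coeff_zero]
  · simp

end Recovery

/-! ### Descent to the prime field and the lifted code -/

/-- Each symbol of `K` is unfolded in a basis over `F`, and recovering sets take all coordinates of
their symbols. -/
theorem exists_pirCode_of_linearMap_extension {F K X W : Type*} [Field F] [Field K] [Algebra F K]
    [FiniteDimensional F K] [Fintype X] [AddCommGroup W] [Module F W] [Module K W]
    [IsScalarTower F K W] (Φ : (X → K) →ₗ[K] W) {k n r : ℕ}
    (hr : Module.finrank K (LinearMap.range Φ) ≤ r)
    (hn : n + Module.finrank F K * r ≤ Module.finrank F K * Fintype.card X)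
    (hrec : ∀ p : X, ∃ R : Fin k → Set X, (∀ j l, j ≠ l → Disjoint (R j) (R l)) ∧
      ∀ (j : Fin k) (c : X → K), Φ c = 0 → (∀ i ∈ R j, c i = 0) → c p = 0) :
    ∃ (N : ℕ) (f : (Fin n → F) → (Fin N → F)), IsPIRCode f k ∧
      N ≤ n + Module.finrank F K * r := by
  set b := Module.finBasis F K
  set e : (X × Fin (Module.finrank F K) → F) →ₗ[F] (X → K) :=
    LinearMap.pi fun x => b.equivFun.symm.toLinearMap ∘ₗ
      LinearMap.funLeft F F (fun t => (x, t)) with he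
  have hex : ∀ c x, e c x = b.equivFun.symm fun t => c (x, t) := fun c x => rfl
  refine exists_pirCode_of_linearMap ((Φ.restrictScalars F).comp e) ?_ ?_ ?_
  · have h1 : LinearMap.range ((Φ.restrictScalars F).comp e) ≤
        (LinearMap.range Φ).restrictScalars F := by
      rintro _ ⟨c, rfl⟩
      exact ⟨e c, rfl⟩
    have : Module.Finite F (LinearMap.range Φ) := Module.Finite.trans K _
    have h2 : Module.finrank F ((LinearMap.range Φ).restrictScalars F) =
        Module.finrank F K * Module.finrank K (LinearMap.range Φ) :=
      (Module.finrank_mul_finrank F K (LinearMap.range Φ)).symm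
    have : Module.Finite F ((LinearMap.range Φ).restrictScalars F) := this
    exact (Submodule.finrank_mono h1).trans (h2.le.trans (Nat.mul_le_mul_left _ hr))
  · rw [Fintype.card_prod, Fintype.card_fin, mul_comm (Fintype.card X)]
    exact hn
  · rintro ⟨p, t⟩
    obtain ⟨R, hRd, hR⟩ := hrec p
    refine ⟨fun j => Prod.fst ⁻¹' R j, fun j l hjl => (hRd j l hjl).preimage _, ?_⟩
    intro j c hc hcR
    have h1 := hR j (e c) hc fun i hi => by
      rw [hex]
      have : (fun t => c (i, t)) = 0 := funext fun t => hcR (i, t) hi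
      rw [this, map_zero]
    rw [hex, LinearEquiv.map_eq_zero_iff] at h1
    exact congrFun h1 t

section LiftedCode

open Polynomial

variable (K : Type*) [Field K] [Fintype K]

/-- All parity checks of order `s` along lines that are transversal to the hyperplane `x 0 = 0`. -/
noncomputable def allLineChecks (m s : ℕ) : ((Fin (m + 1) → K) × jetIndex (m + 1) s → K) →ₗ[K]
    ((Fin (m + 1) → K) × (Fin m → K) × Fin s → K) :=
  LinearMap.pi fun y => lineCheck y.1 (Fin.cons 1 y.2.1) y.2.2

variable {K}

theorem allLineChecks_eq_zero {m s : ℕ} {f : (Fin (m + 1) → K) × jetIndex (m + 1) s → K}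
    (h : allLineChecks K m s f = 0) (a : Fin (m + 1) → K) (b : Fin m → K) {j : ℕ} (hj : j < s) :
    lineCheck a (Fin.cons 1 b) j f = 0 :=
  congrFun h (a, b, ⟨j, hj⟩)

theorem finrank_range_allLineChecks_le [CharP K 2] {m σ T : ℕ} (hT : 1 ≤ T)
    (hK : Fintype.card K = 2 ^ (T + σ)) (hm : m + 1 ≤ 2 ^ σ) :
    Module.finrank K (LinearMap.range (allLineChecks K m (2 ^ σ))) ≤
      (2 ^ σ) ^ (m + 1) * (carrySet (m + 1) T 0).card * ((2 ^ σ) ^ m * (m + 1)) := by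
  classical
  set E : (Fin (m + 1) → ℕ) → ((Fin (m + 1) → K) × jetIndex (m + 1) (2 ^ σ) → K) :=
    fun d => prodJet (2 ^ σ) fun r => (X : K[X]) ^ d r with hE
  set B := (reducedExponents (m + 1) (2 ^ (T + σ)) (2 ^ σ)).filter
    fun d => IsBadExponent (2 ^ (T + σ)) (2 ^ σ) d with hB
  have hrange : LinearMap.range (allLineChecks K m (2 ^ σ)) ≤
      Submodule.span K ((B.image fun d => allLineChecks K m (2 ^ σ) (E d) : Finset _) : Set _) := by
    rw [LinearMap.range_eq_map, ← span_prodJet_eq_top, Submodule.map_span, Submodule.span_le]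
    rintro _ ⟨_, ⟨d, hd, rfl⟩, rfl⟩
    rw [hK] at hd
    by_cases h0 : allLineChecks K m (2 ^ σ) (E d) = 0
    · change allLineChecks K m (2 ^ σ) (E d) ∈ _
      rw [h0]
      exact Submodule.zero_mem _
    · refine Submodule.subset_span ?_
      rw [Finset.mem_coe, Finset.mem_image]
      refine ⟨d, Finset.mem_filter.2 ⟨hd, ?_⟩, rfl⟩
      obtain ⟨⟨a, b, j⟩, hy⟩ := Function.ne_iff.1 h0
      exact isBadExponent_of_lineCheck_ne_zero hT hK (Nat.succ_pos m) hm j.2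
        (Finset.mem_filter.1 hd).2 hy
  refine (Submodule.finrank_mono hrange).trans ((finrank_span_finset_le_card _).trans ?_)
  exact Finset.card_image_le.trans
    (card_isBadExponent_le hT B fun d hd => (Finset.mem_filter.1 hd).2)

/-- Pairwise disjoint recovering sets: the punctured lines through `p` are grouped by the cells of a
grid that contain their directions. -/
theorem exists_recoveringSets {m s Q k : ℕ} (hK : Fintype.card K = Q * s) (hk : k ≤ Q ^ m)
    (p : Fin (m + 1) → K) :
    ∃ R : Fin k → Set (Fin (m + 1) → K), (∀ j l, j ≠ l → Disjoint (R j) (R l)) ∧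
      ∀ (j : Fin k) (f : (Fin (m + 1) → K) × jetIndex (m + 1) s → K), allLineChecks K m s f = 0 →
        (∀ x ∈ R j, ∀ i, f (x, i) = 0) → ∀ i, f (p, i) = 0 := by
  classical
  -- The field is cut into `Q` blocks of size `s`; grid cells are products of `m` blocks.
  let e : K ≃ Fin Q × Fin s := Fintype.equivOfCardEq (by simp [hK])
  let u : Fin (Q ^ m) ≃ (Fin m → Fin Q) := Fintype.equivOfCardEq (by simp)
  let S : (Fin m → Fin Q) → Fin m → Finset K := fun κ r => Finset.univ.filter fun x => (e x).1 = κ r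
  have hS : ∀ κ r, s ≤ (S κ r).card := by
    intro κ r
    calc s = (Finset.univ.image fun t : Fin s => e.symm (κ r, t)).card := by
          rw [Finset.card_image_of_injective, Finset.card_univ, Fintype.card_fin]
          intro t t' htt
          simpa using htt
      _ ≤ (S κ r).card := by
          refine Finset.card_le_card fun x hx => ?_
          obtain ⟨t, -, rfl⟩ := Finset.mem_image.1 hx
          simp [S]
  refine ⟨fun j => {x | ∃ t : K, t ≠ 0 ∧ ∃ b : Fin m → K, (∀ r, b r ∈ S (u (Fin.castLE hk j)) r) ∧
    x = p + t • (Fin.cons 1 b : Fin (m + 1) → K)}, ?_, ?_⟩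
  · intro j l hjl
    rw [Set.disjoint_left]
    rintro x ⟨t, ht, b, hb, rfl⟩ ⟨t', -, b', hb', hx⟩
    have h1 := add_left_cancel hx
    -- The first coordinate of every direction is 1, so a point determines its parameter and then
    -- its direction.
    have h2 : t = t' := by
      have := congrFun h1 0
      simpa using this
    subst h2
    have h3 : b = b' := by
      funext r
      have := congrFun h1 r.succ
      simpa [ht] using this
    subst h3
    refine hjl ((Fin.castLE_injective hk) (u.injective (funext fun r => ?_)))
    rw [← (Finset.mem_filter.1 (hb r)).2, ← (Finset.mem_filter.1 (hb' r)).2]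
  · intro j f hf hR i
    refine eq_zero_of_forall_grid (g := fun i => f (p, i)) (S (u (Fin.castLE hk j))) (hS _) ?_ i
    intro b hb w hw
    refine sum_eq_zero_of_lineCheck_eq_zero (fun j hj => allLineChecks_eq_zero hf p b hj) ?_ hw
    intro t ht i
    exact hR _ ⟨t, ht, b, hb, rfl⟩ i

end LiftedCode

theorem exists_lifted_pirCode {m σ T k n r : ℕ} (hT : 1 ≤ T) (hm : m + 1 ≤ 2 ^ σ)
    (hk : k ≤ (2 ^ T) ^ m)
    (hr : (2 ^ σ) ^ (m + 1) * (carrySet (m + 1) T 0).card * ((2 ^ σ) ^ m * (m + 1)) ≤ r)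
    (hn : n + (T + σ) * r ≤
      (T + σ) * ((2 ^ (T + σ)) ^ (m + 1) * (jetIndex (m + 1) (2 ^ σ)).card)) :
    ∃ (N : ℕ) (F : (Fin n → Fin 2) → (Fin N → Fin 2)), IsPIRCode F k ∧ N ≤ n + (T + σ) * r := by
  classical
  let K := GaloisField 2 (T + σ)
  have hfin : Finite K := inferInstance
  let _ : Fintype K := Fintype.ofFinite K
  have hℓ : T + σ ≠ 0 := by omega
  have hK : Fintype.card K = 2 ^ (T + σ) := by
    rw [← Nat.card_eq_fintype_card]
    exact GaloisField.card 2 _ hℓ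
  have hrank : Module.finrank (ZMod 2) K = T + σ := GaloisField.finrank 2 hℓ
  have main := exists_pirCode_of_linearMap_extension (F := ZMod 2) (k := k) (n := n) (r := r)
    (allLineChecks K m (2 ^ σ)) ((finrank_range_allLineChecks_le hT hK hm).trans hr) ?_ ?_
  · rw [hrank] at main
    exact main
  · rw [hrank, Fintype.card_prod, Fintype.card_pi, Fintype.card_coe]
    simpa [hK] using hn
  · rintro ⟨p, i⟩
    obtain ⟨R, hRd, hR⟩ := exists_recoveringSets (s := 2 ^ σ) (hK.trans (pow_add 2 T σ)) hk p
    refine ⟨fun j => Prod.fst ⁻¹' R j, fun j l hjl => (hRd j l hjl).preimage _, ?_⟩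
    intro j c hc hcR
    exact hR j c hc (fun x hx i => hcR (x, i) hx) i

/-- A cube inside the simplex; only a factor independent of `σ` is lost. -/
theorem le_card_jetIndex {m σ μ : ℕ} (hm : m ≤ 2 ^ μ) (hm0 : 0 < m) (hμ : μ ≤ σ) :
    (2 ^ (σ - μ)) ^ m ≤ (jetIndex m (2 ^ σ)).card := by
  have h1 : ((Fintype.piFinset fun _ : Fin m => Finset.range (2 ^ (σ - μ)))).card =
      (2 ^ (σ - μ)) ^ m := by
    rw [Fintype.card_piFinset]
    simp
  rw [← h1]
  refine Finset.card_le_card fun i hi => mem_jetIndex.2 ?_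
  have hi' : ∀ r, i r < 2 ^ (σ - μ) := fun r => Finset.mem_range.1 (Fintype.mem_piFinset.1 hi r)
  have h2 : ∑ r, (i r + 1) ≤ ∑ _r : Fin m, 2 ^ (σ - μ) := Finset.sum_le_sum fun r _ => hi' r
  rw [Finset.sum_add_distrib] at h2
  simp only [Finset.sum_const, Finset.card_univ, Fintype.card_fin, smul_eq_mul, mul_one] at h2
  have h3 : 2 ^ μ * 2 ^ (σ - μ) = 2 ^ σ := by rw [← pow_add, Nat.add_sub_cancel' hμ]
  have h4 := Nat.mul_le_mul_right (2 ^ (σ - μ)) hm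
  omega

/-! ### The redundancy exponent -/

theorem topEigenvalue_pos {m : ℕ} (hm : 0 < m) : 0 < topEigenvalue m := by
  have h1 : (2 : ℝ) ≤ 2 ^ m := le_self_pow₀ one_le_two hm.ne'
  have := two_pow_sub_one_le_topEigenvalue hm
  linarith

theorem logb_topEigenvalue_le {m : ℕ} (hm : 0 < m) : Real.logb 2 (topEigenvalue m) ≤ m := by
  rw [Real.logb_le_iff_le_rpow one_lt_two (topEigenvalue_pos hm), Real.rpow_natCast]
  exact topEigenvalue_le m

/-- This says that the slope of `redundancyExponent` in `ε` is positive. -/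
theorem lt_logb_topEigenvalue {m : ℕ} (hm : 2 ≤ m) :
    (m : ℝ) - 1 / 2 < Real.logb 2 (topEigenvalue m) := by
  have hm0 : 0 < m := by omega
  rw [Real.lt_logb_iff_rpow_lt one_lt_two (topEigenvalue_pos hm0)]
  refine lt_of_lt_of_le ?_ (two_pow_sub_one_le_topEigenvalue hm0)
  have h4 : (4 : ℝ) ≤ 2 ^ m := by
    have := pow_le_pow_right₀ (one_le_two (α := ℝ)) hm
    linarith
  have hhalf : ((2 : ℝ) ^ (-(1 / 2) : ℝ)) < 3 / 4 := by
    have h1 : ((2 : ℝ) ^ (-(1 / 2) : ℝ)) ^ 2 = 1 / 2 := by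
      rw [← Real.rpow_natCast, ← Real.rpow_mul zero_le_two]
      norm_num [Real.rpow_neg_one]
    have h2 : 0 ≤ (2 : ℝ) ^ (-(1 / 2) : ℝ) := by positivity
    nlinarith
  rw [sub_eq_add_neg, Real.rpow_add zero_lt_two, Real.rpow_natCast]
  nlinarith

/-- The exponent of the redundancy of binary PIR codes from lifted multiplicity codes in `m`
variables. -/
noncomputable def redundancyExponent (m : ℕ) (ε : ℝ) : ℝ :=
  (2 * (m : ℝ) - 1) / (2 * m) +
    (1 + 2 * Real.logb 2 (topEigenvalue m) - 2 * m) / (2 * (m : ℝ) - 2) * ε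

theorem redundancyExponent_succ {m : ℕ} (hm : 1 ≤ m) (ε : ℝ) :
    redundancyExponent (m + 1) ε = (2 * m + 1) / (2 * (m + 1)) - (2 * m + 1) * ε / (2 * m) +
      Real.logb 2 (topEigenvalue (m + 1)) * ε / m := by
  have h1 : (m : ℝ) ≠ 0 := by positivity
  have h2 : (2 * ((m + 1 : ℕ) : ℝ) - 2) = 2 * m := by
    push_cast
    ring
  rw [redundancyExponent, h2]
  push_cast
  field_simp
  ring

theorem redundancyExponent_succ_le_one {m : ℕ} (hm : 1 ≤ m) {ε : ℝ} (hε : 0 ≤ ε)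
    (hε' : ε ≤ m / (m + 1)) : redundancyExponent (m + 1) ε ≤ 1 := by
  have hm0 : (0 : ℝ) < m := by exact_mod_cast hm
  rw [redundancyExponent_succ hm]
  have h1 := logb_topEigenvalue_le (Nat.succ_pos m)
  push_cast at h1
  have h2 : Real.logb 2 (topEigenvalue (m + 1)) * ε / m ≤ (m + 1) * ε / m := by gcongr
  have h3 : ε / (2 * m) ≤ 1 / (2 * (m + 1)) := by
    rw [div_le_div_iff₀ (by positivity) (by positivity)]
    rw [le_div_iff₀ (by positivity)] at hε'
    linarith
  have h4 : (2 * (m : ℝ) + 1) / (2 * (m + 1)) - (2 * m + 1) * ε / (2 * m) + (m + 1) * ε / m =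
      1 - 1 / (2 * (m + 1)) + ε / (2 * m) := by
    field_simp
    ring
  linarith

theorem redundancyExponent_lt_one {m : ℕ} (hm : 2 ≤ m) {ε : ℝ} (hε : 0 ≤ ε)
    (hε' : ε < (m - 1) / m) : redundancyExponent m ε < 1 := by
  have hm2 : (2 : ℝ) ≤ m := by exact_mod_cast hm
  have h1 := logb_topEigenvalue_le (m := m) (by omega)
  have h2 : (1 + 2 * Real.logb 2 (topEigenvalue m) - 2 * m) / (2 * (m : ℝ) - 2) * ε ≤
      1 / (2 * (m : ℝ) - 2) * ε := by
    refine mul_le_mul_of_nonneg_right ?_ hε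
    exact div_le_div_of_nonneg_right (by linarith) (by linarith)
  have h3 : 1 / (2 * (m : ℝ) - 2) * ε < 1 / (2 * m) := by
    rw [lt_div_iff₀ (by linarith)] at hε'
    rw [one_div_mul_eq_div, div_lt_div_iff₀ (by linarith) (by linarith)]
    linarith
  have h4 : (2 * (m : ℝ) - 1) / (2 * m) = 1 - 1 / (2 * m) := by
    field_simp
  rw [redundancyExponent, h4]
  linarith

theorem le_redundancyExponent {m : ℕ} (hm : 2 ≤ m) {ε : ℝ} (hε : 0 ≤ ε) :
    1 - 1 / (2 * (m : ℝ)) ≤ redundancyExponent m ε := by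
  have hm2 : (2 : ℝ) ≤ m := by exact_mod_cast hm
  have h1 := lt_logb_topEigenvalue hm
  have h4 : (2 * (m : ℝ) - 1) / (2 * m) = 1 - 1 / (2 * m) := by
    field_simp
  rw [redundancyExponent, h4, le_add_iff_nonneg_right]
  exact mul_nonneg (div_nonneg (by linarith) (by linarith)) hε

/-! ### Choice of parameters -/

theorem eventually_const_mul_le_two_rpow {a : ℝ} (ha : 0 < a) (A : ℝ) :
    ∀ᶠ x : ℝ in Filter.atTop, A * x ≤ (2 : ℝ) ^ (a * x) := by
  have hb : 0 < Real.log 2 * a := mul_pos (Real.log_pos one_lt_two) ha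
  have h := (isLittleO_pow_exp_pos_mul_atTop (k := 1) hb).bound
    (show (0 : ℝ) < 1 / (|A| + 1) by positivity)
  filter_upwards [h, Filter.eventually_ge_atTop 0] with x hx hx0
  rw [pow_one, Real.norm_of_nonneg hx0, Real.norm_of_nonneg (Real.exp_pos _).le, one_div_mul_eq_div,
    le_div_iff₀ (by positivity)] at hx
  rw [Real.rpow_def_of_pos two_pos, ← mul_assoc]
  have := mul_le_mul_of_nonneg_right (le_abs_self A) hx0
  nlinarith

theorem eventually_exists_pirCode {m : ℕ} (hm : 1 ≤ m) {ε η : ℝ} (hε : 0 < ε)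
    (hε' : ε ≤ m / (m + 1)) (hη : 0 < η) :
    ∀ᶠ n : ℕ in Filter.atTop, ∃ (N : ℕ) (F : (Fin n → Fin 2) → (Fin N → Fin 2)),
      IsPIRCode F ⌈(n : ℝ) ^ ε⌉₊ ∧
        (N : ℝ) - n ≤ (n : ℝ) ^ (redundancyExponent (m + 1) ε + η) := by
  have hm0 : (0 : ℝ) < m := by exact_mod_cast hm
  have hm1 : (1 : ℝ) ≤ m := by exact_mod_cast hm
  set Λ := Real.logb 2 (topEigenvalue (m + 1)) with hΛ
  have hf := redundancyExponent_succ hm ε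
  have hf1 := redundancyExponent_succ_le_one hm hε.le hε'
  set f := redundancyExponent (m + 1) ε with hfdef
  rw [← hΛ] at hf
  -- Raising `σ` by `θ * L` costs `(2 * m + 1) * θ * L` in the exponent. The remaining `θ * L`
  -- covers three losses of `θ * L / 4`: the factor `T + σ`, the gap between `τ` and the eigenvalue,
  -- and the constants in `c₀`.
  set θ := η / (2 * (m + 1)) with hθ
  have hθ0 : 0 < θ := by positivity
  have hηθ : η = 2 * (m + 1) * θ := by
    rw [hθ]
    field_simp
  have hΛ0 : 0 < Λ := by
    have := lt_logb_topEigenvalue (m := m + 1) (by omega)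
    push_cast at this
    linarith
  set τ : ℝ := 2 ^ (Λ + θ / 4) with hτ
  have hτgt : topEigenvalue (m + 1) < τ := by
    conv_lhs => rw [← Real.rpow_logb two_pos (by norm_num) (topEigenvalue_pos (Nat.succ_pos m))]
    exact Real.rpow_lt_rpow_of_exponent_lt one_lt_two (by linarith)
  obtain ⟨v, hv, hvA⟩ := exists_pos_mulVec_carryMatrix hτgt
  obtain ⟨C, hC0, hC⟩ := exists_card_carrySet_le (by positivity : (0 : ℝ) ≤ τ) hv
    (fun i => (hvA i).le) 0
  set D := Real.logb 2 ((m + 1) * C) with hD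
  have hD2 : (2 : ℝ) ^ D = (m + 1) * C := Real.rpow_logb two_pos (by norm_num) (by positivity)
  obtain ⟨μ, hμ2⟩ : ∃ μ, m + 1 ≤ 2 ^ μ := ⟨m + 1, Nat.lt_two_pow_self.le⟩
  set c₀ : ℝ := D + (2 * m + 1) * (μ + 2) + (Λ + θ / 4) with hc₀
  have hL : Filter.Tendsto (fun n : ℕ => Real.logb 2 (n : ℝ)) Filter.atTop Filter.atTop :=
    (Real.tendsto_logb_atTop one_lt_two).comp tendsto_natCast_atTop_atTop
  filter_upwards [hL.eventually (eventually_const_mul_le_two_rpow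
      (show 0 < θ / 4 by positivity) (μ + 5 + θ)),
    hL.eventually (Filter.eventually_ge_atTop (c₀ / (θ / 4))),
    hL.eventually (Filter.eventually_ge_atTop 1), Filter.eventually_ge_atTop 1] with n hn1 hn2 hn3 hn4
  have hn0 : (0 : ℝ) < n := by exact_mod_cast hn4
  have hnL : (2 : ℝ) ^ Real.logb 2 n = n := Real.rpow_logb two_pos (by norm_num) hn0
  have hnpow : ∀ x : ℝ, (n : ℝ) ^ x = 2 ^ (Real.logb 2 n * x) := fun x => by
    rw [Real.rpow_mul zero_le_two, hnL]
  set L := Real.logb 2 (n : ℝ) with hLdef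
  have hL0 : 0 < L := by linarith
  rw [div_le_iff₀ (by positivity)] at hn2
  -- This is twice the main term of `σ`, nonnegative because `ε ≤ m / (m + 1)`.
  have hgap : 0 ≤ L / (m + 1) - ε * L / m := by
    rw [sub_nonneg, div_le_div_iff₀ hm0 (by positivity)]
    rw [le_div_iff₀ (by positivity)] at hε'
    nlinarith
  set T := ⌈ε * L / m⌉₊ with hT
  set u := ⌈θ * L + (L / (m + 1) - ε * L / m) / 2⌉₊ with hu
  have hT1 : ε * L / m ≤ T := Nat.le_ceil _
  have hT2 : (T : ℝ) < ε * L / m + 1 := Nat.ceil_lt_add_one (by positivity)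
  have hu1 : θ * L + (L / (m + 1) - ε * L / m) / 2 ≤ u := Nat.le_ceil _
  have hu2 : (u : ℝ) < θ * L + (L / (m + 1) - ε * L / m) / 2 + 1 :=
    Nat.ceil_lt_add_one (by positivity)
  have hTpos : 1 ≤ T := Nat.ceil_pos.2 (by positivity)
  -- The summand `μ` compensates for the smaller cube in `le_card_jetIndex`.
  set σ := μ + 1 + u with hσ
  have hσR : (σ : ℝ) = μ + 1 + u := by
    rw [hσ]
    push_cast
    ring
  set r := (2 ^ σ) ^ (m + 1) * (carrySet (m + 1) T 0).card * ((2 ^ σ) ^ m * (m + 1)) with hr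
  have hrle : (r : ℝ) ≤ 2 ^ (D + (2 * m + 1) * σ + (Λ + θ / 4) * T) := by
    have h1 : (r : ℝ) = ((m + 1) * (2 : ℝ) ^ ((2 * m + 1) * σ)) * (carrySet (m + 1) T 0).card := by
      rw [hr]
      push_cast
      rw [← pow_mul, ← pow_mul]
      have : (2 : ℝ) ^ ((2 * m + 1) * σ) = 2 ^ (σ * (m + 1)) * 2 ^ (σ * m) := by
        rw [← pow_add]
        congr 1
        ring
      rw [this]
      ring
    have h2 : (2 : ℝ) ^ (D + (2 * m + 1) * σ + (Λ + θ / 4) * T) =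
        ((m + 1) * (2 : ℝ) ^ ((2 * m + 1) * σ)) * (C * τ ^ T) := by
      have h3 : (2 : ℝ) ^ ((2 * m + 1) * (σ : ℝ)) = 2 ^ ((2 * m + 1) * σ) := by
        rw [← Real.rpow_natCast]
        push_cast
        rfl
      rw [Real.rpow_add two_pos, Real.rpow_add two_pos, hD2, h3, Real.rpow_mul_natCast zero_le_two,
        ← hτ]
      ring
    rw [h1, h2]
    exact mul_le_mul_of_nonneg_left (hC T) (by positivity)
  have hTσ : ((T + σ : ℕ) : ℝ) ≤ 2 ^ (θ / 4 * L) := by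
    refine le_trans ?_ hn1
    push_cast
    rw [hσR]
    have h1 : ε * L / m ≤ L := by
      have h2 : L / (m + 1) ≤ L := div_le_self hL0.le (by linarith)
      linarith
    have h2 : L / (m + 1) ≤ L := div_le_self hL0.le (by linarith)
    have h3 : 0 ≤ ε * L / m := by positivity
    have h4 : (μ : ℝ) ≤ μ * L := le_mul_of_one_le_right (Nat.cast_nonneg _) hn3
    linarith
  have hrTσ : (((T + σ) * r : ℕ) : ℝ) ≤ (n : ℝ) ^ (f + η) := by
    have h1 : (((T + σ) * r : ℕ) : ℝ) ≤
        2 ^ (θ / 4 * L) * 2 ^ (D + (2 * m + 1) * σ + (Λ + θ / 4) * T) := by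
      rw [Nat.cast_mul]
      exact mul_le_mul hTσ hrle (Nat.cast_nonneg _) (by positivity)
    refine h1.trans ?_
    rw [← Real.rpow_add two_pos, hnpow]
    refine Real.rpow_le_rpow_of_exponent_le one_le_two ?_
    have h2 : (2 * m + 1) * (σ : ℝ) ≤
        (2 * m + 1) * (μ + 2 + (θ * L + (L / (m + 1) - ε * L / m) / 2)) := by
      refine mul_le_mul_of_nonneg_left ?_ (by positivity)
      linarith
    have h3 : (Λ + θ / 4) * T ≤ (Λ + θ / 4) * (ε * L / m + 1) :=
      mul_le_mul_of_nonneg_left hT2.le (by positivity)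
    have h4 : L * f = (2 * m + 1) * ((L / (m + 1) - ε * L / m) / 2) + Λ * (ε * L / m) := by
      rw [hf]
      field_simp
    have h5 : θ / 4 * (ε * L / m) ≤ θ / 4 * L := by
      refine mul_le_mul_of_nonneg_left ?_ (by positivity)
      have : L / (m + 1) ≤ L := div_le_self hL0.le (by linarith)
      linarith
    have h6 : L * (f + η) = L * f + 2 * m * (θ * L) + 2 * (θ * L) := by
      rw [hηθ]
      ring
    have h7 : 0 < θ * L := by positivity
    rw [h6, h4]
    rw [hc₀] at hn2
    generalize (L / (m + 1) - ε * L / m) / 2 = G at *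
    generalize ε * L / m = x at *
    linarith
  have hk : ⌈(n : ℝ) ^ ε⌉₊ ≤ (2 ^ T) ^ m := by
    rw [Nat.ceil_le, hnpow]
    push_cast
    rw [← pow_mul, ← Real.rpow_natCast]
    refine Real.rpow_le_rpow_of_exponent_le one_le_two ?_
    rw [div_le_iff₀ hm0] at hT1
    push_cast
    linarith
  have hbig : (n : ℝ) + ((T + σ) * r : ℕ) ≤
      ((2 ^ (T + σ)) ^ (m + 1) * (2 ^ (σ - μ)) ^ (m + 1) : ℕ) := by
    have h1 : (n : ℝ) ≤ (n : ℝ) ^ (1 + η) := by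
      conv_lhs => rw [← Real.rpow_one (n : ℝ)]
      exact Real.rpow_le_rpow_of_exponent_le (by exact_mod_cast hn4) (by linarith)
    have h2 : (n : ℝ) ^ (f + η) ≤ (n : ℝ) ^ (1 + η) :=
      Real.rpow_le_rpow_of_exponent_le (by exact_mod_cast hn4) (by linarith)
    have h3 : σ - μ = 1 + u := by omega
    have h4 : (((2 ^ (T + σ)) ^ (m + 1) * (2 ^ (σ - μ)) ^ (m + 1) : ℕ) : ℝ) =
        2 ^ (((m : ℝ) + 1) * (T + σ + (1 + u))) := by
      rw [h3]
      push_cast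
      rw [← pow_mul, ← pow_mul, ← pow_add, ← Real.rpow_natCast]
      congr 1
      push_cast
      ring
    rw [h4]
    have h5 : (2 : ℝ) * (n : ℝ) ^ (1 + η) ≤ 2 ^ (((m : ℝ) + 1) * (T + σ + (1 + u))) := by
      rw [hnpow]
      conv_lhs => rw [← Real.rpow_one (2 : ℝ), Real.rpow_one, ← Real.rpow_one_add' zero_le_two
        (by positivity)]
      refine Real.rpow_le_rpow_of_exponent_le one_le_two ?_
      have h6 : ((m : ℝ) + 1) * (ε * L / m + (μ + 2) + 2 * (θ * L + (L / (m + 1) - ε * L / m) / 2))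
          ≤ ((m : ℝ) + 1) * (T + σ + (1 + u)) := by
        refine mul_le_mul_of_nonneg_left ?_ (by positivity)
        rw [hσR]
        linarith
      refine le_trans ?_ h6
      have h7 : ((m : ℝ) + 1) *
          (ε * L / m + (μ + 2) + 2 * (θ * L + (L / (m + 1) - ε * L / m) / 2)) =
          ((m : ℝ) + 1) * (μ + 2) + L * (1 + η) := by
        rw [hηθ]
        field_simp
        ring
      rw [h7]
      have h8 : (0 : ℝ) ≤ μ := Nat.cast_nonneg _
      have h9 : 1 ≤ ((m : ℝ) + 1) * (μ + 2) :=
        one_le_mul_of_one_le_of_one_le (by linarith) (by linarith)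
      linarith
    linarith
  have hn5 : n + (T + σ) * r ≤
      (T + σ) * ((2 ^ (T + σ)) ^ (m + 1) * (jetIndex (m + 1) (2 ^ σ)).card) := by
    have h1 : n + (T + σ) * r ≤ (2 ^ (T + σ)) ^ (m + 1) * (2 ^ (σ - μ)) ^ (m + 1) := by
      exact_mod_cast hbig
    refine h1.trans ((Nat.mul_le_mul_left _
      (le_card_jetIndex hμ2 (Nat.succ_pos m) (by omega))).trans ?_)
    exact Nat.le_mul_of_pos_left _ (by omega)
  obtain ⟨N, F, hF, hN⟩ := exists_lifted_pirCode hTpos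
    (hμ2.trans (Nat.pow_le_pow_right two_pos (by omega))) hk hr.ge hn5
  refine ⟨N, F, hF, le_trans ?_ hrTσ⟩
  have : (N : ℝ) ≤ (n : ℝ) + ((T + σ) * r : ℕ) := by exact_mod_cast hN
  linarith

/-! ### From codes to the two asymptotic bounds -/

theorem isPIRCode_id {A : Type*} (n : ℕ) : IsPIRCode (fun x : Fin n → A => x) 1 := by
  intro i
  refine ⟨fun _ => {i}, fun j l hjl => absurd (Subsingleton.elim j l) hjl,
    fun _ y => y ⟨i, Finset.mem_singleton_self i⟩, fun _ _ => rfl⟩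

theorem IsPIRCode.length_le {n N k : ℕ} (hk : 0 < k) {F : (Fin n → Fin 2) → (Fin N → Fin 2)}
    (hF : IsPIRCode F k) : n ≤ N := by
  have hinj : Function.Injective F := by
    intro x y hxy
    funext i
    obtain ⟨R, -, g, hg⟩ := hF i
    rw [← hg x ⟨0, hk⟩, ← hg y ⟨0, hk⟩, hxy]
  have h := Fintype.card_le_of_injective F hinj
  simp only [Fintype.card_pi, Fintype.card_fin, Finset.prod_const, Finset.card_univ] at h
  exact (Nat.pow_le_pow_iff_right (by norm_num)).1 h

theorem pirRedundancy_nonneg {n k N : ℕ} (hk : 0 < k) {F : (Fin n → Fin 2) → (Fin N → Fin 2)}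
    (hF : IsPIRCode F k) : 0 ≤ pirRedundancy 2 n k := by
  have hne : {N : ℕ | ∃ F : (Fin n → Fin 2) → (Fin N → Fin 2), IsPIRCode F k}.Nonempty :=
    ⟨N, F, hF⟩
  obtain ⟨F', hF'⟩ := Nat.sInf_mem hne
  rw [pirRedundancy, sub_nonneg, Nat.cast_le]
  exact hF'.length_le hk

theorem pirRedundancy_le {n k N : ℕ} {F : (Fin n → Fin 2) → (Fin N → Fin 2)}
    (hF : IsPIRCode F k) : pirRedundancy 2 n k ≤ N - n := by
  rw [pirRedundancy, sub_le_sub_iff_right, Nat.cast_le]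
  exact Nat.sInf_le ⟨F, hF⟩

theorem exists_pirCode_of_lt {m : ℕ} (hm : 1 ≤ m) {ε δ : ℝ} (hε : 0 < ε)
    (hε' : ε < ((m : ℝ) - 1) / m) (hδ : 0 < δ) :
    ∃ n₀ : ℕ, ∀ n : ℕ, n₀ ≤ n → ∃ (N : ℕ) (F : (Fin n → Fin 2) → (Fin N → Fin 2)),
      IsPIRCode F ⌈(n : ℝ) ^ (ε - δ)⌉₊ ∧ (N : ℝ) - n ≤ (n : ℝ) ^ redundancyExponent m ε := by
  obtain ⟨m, rfl⟩ : ∃ k, m = k + 1 := ⟨m - 1, by omega⟩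
  have hm1 : 1 ≤ m := by
    by_contra h
    obtain rfl : m = 0 := by omega
    norm_num at hε'
    linarith
  have hm0 : (0 : ℝ) < m := by exact_mod_cast hm1
  -- If `ε - δ ≤ 0`, a single recovering set is required and the identity code has no redundancy.
  -- Otherwise the drop of the exponent from `ε` to `ε - δ` serves as `η`.
  rcases le_or_gt (ε - δ) 0 with h0 | h0
  · refine ⟨1, fun n hn => ⟨n, fun x => x, ?_, ?_⟩⟩
    · have hn1 : (1 : ℝ) ≤ n := by exact_mod_cast hn
      have h1 : ⌈(n : ℝ) ^ (ε - δ)⌉₊ = 1 := by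
        rw [Nat.ceil_eq_iff one_ne_zero]
        refine ⟨?_, by simpa using Real.rpow_le_one_of_one_le_of_nonpos hn1 h0⟩
        simpa using Real.rpow_pos_of_pos (by linarith : (0 : ℝ) < n) _
      rw [h1]
      exact isPIRCode_id n
    · rw [sub_self]
      positivity
  · have hslope := lt_logb_topEigenvalue (m := m + 1) (by omega)
    push_cast at hslope hε'
    set η := redundancyExponent (m + 1) ε - redundancyExponent (m + 1) (ε - δ) with hη
    have hη0 : 0 < η := by
      have h1 : η = (1 + 2 * Real.logb 2 (topEigenvalue (m + 1)) - 2 * ((m : ℝ) + 1)) / (2 * m) *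
          δ := by
        rw [hη, redundancyExponent_succ hm1, redundancyExponent_succ hm1]
        field_simp
        ring
      rw [h1]
      exact mul_pos (div_pos (by linarith) (by linarith)) hδ
    rw [add_sub_cancel_right] at hε'
    have h2 := eventually_exists_pirCode hm1 h0 (by linarith) hη0
    rw [hη, add_sub_cancel] at h2
    exact Filter.eventually_atTop.1 h2

theorem exists_isLeast_redundancyExponent {ε : ℝ} (hε : 0 < ε) (hε' : ε < 1) :
    ∃ m₀ : ℕ, ⌈1 / (1 - ε)⌉₊ ≤ m₀ ∧ ∀ m : ℕ, ⌈1 / (1 - ε)⌉₊ ≤ m →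
      redundancyExponent m₀ ε ≤ redundancyExponent m ε := by
  have hpos : 0 < 1 - ε := by linarith
  have htwo : ∀ m : ℕ, ⌈1 / (1 - ε)⌉₊ ≤ m → 2 ≤ m := by
    intro m hm
    have h1 : (1 : ℝ) < 1 / (1 - ε) := by
      rw [lt_div_iff₀ hpos]
      linarith
    have h2 : (1 : ℝ) < m := h1.trans_le (Nat.ceil_le.1 hm)
    exact_mod_cast h2
  set M := ⌈1 / (1 - ε)⌉₊ with hM
  -- At `M` itself `ε = (M - 1) / M` is possible; the next index makes the inequality strict.
  have hM1 : redundancyExponent (M + 1) ε < 1 := by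
    refine redundancyExponent_lt_one (htwo _ (Nat.le_succ M)) hε.le ?_
    have h1 : 1 / (1 - ε) < (M : ℝ) + 1 := (Nat.le_ceil _).trans_lt (lt_add_one _)
    rw [div_lt_iff₀ hpos] at h1
    push_cast
    rw [lt_div_iff₀ (by positivity)]
    linarith
  obtain ⟨B, hB⟩ := exists_nat_gt (1 / (2 * (1 - redundancyExponent (M + 1) ε)))
  have hlarge : ∀ m : ℕ, M ≤ m → B ≤ m → redundancyExponent (M + 1) ε ≤ redundancyExponent m ε := by
    intro m hm hBm
    refine le_trans ?_ (le_redundancyExponent (htwo m hm) hε.le)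
    have hm0 : (0 : ℝ) < m := by
      have := htwo m hm
      positivity
    have h1 : 1 / (2 * (1 - redundancyExponent (M + 1) ε)) < m :=
      hB.trans_le (by exact_mod_cast hBm)
    rw [div_lt_iff₀ (by linarith)] at h1
    have h2 : 1 / (2 * (m : ℝ)) ≤ 1 - redundancyExponent (M + 1) ε := by
      rw [div_le_iff₀ (by positivity)]
      linarith
    linarith
  obtain ⟨m₀, hm₀, hmin⟩ := Finset.exists_min_image (Finset.Icc M (M + 1 + B))
    (fun m => redundancyExponent m ε) ⟨M, Finset.mem_Icc.2 ⟨le_rfl, by omega⟩⟩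
  refine ⟨m₀, (Finset.mem_Icc.1 hm₀).1, fun m hm => ?_⟩
  by_cases hmB : m ≤ M + 1 + B
  · exact hmin m (Finset.mem_Icc.2 ⟨hm, hmB⟩)
  · exact (hmin (M + 1) (Finset.mem_Icc.2 ⟨by omega, by omega⟩)).trans (hlarge m hm (by omega))

theorem exists_logb_pirRedundancy_le {m : ℕ} {ε η : ℝ} (hε : 0 < ε) (hε' : ε < 1)
    (hm : ⌈1 / (1 - ε)⌉₊ ≤ m) (hη : 0 < η) :
    ∃ n₀ : ℕ, ∀ n : ℕ, n₀ ≤ n →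
      Real.logb n (pirRedundancy 2 n ⌈(n : ℝ) ^ ε⌉₊) ≤ redundancyExponent m ε + η := by
  have hpos : 0 < 1 - ε := by linarith
  have h1 : 1 / (1 - ε) ≤ m := Nat.ceil_le.1 hm
  rw [div_le_iff₀ hpos] at h1
  have hm1 : (1 : ℝ) < m := by nlinarith
  obtain ⟨m, rfl⟩ : ∃ k, m = k + 1 := ⟨m - 1, by
    have : 1 < m := by exact_mod_cast hm1
    omega⟩
  push_cast at h1 hm1
  have hm0 : 1 ≤ m := by
    have : (0 : ℝ) < m := by linarith
    exact_mod_cast this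
  have h2 : ε ≤ (m : ℝ) / (m + 1) := by
    rw [le_div_iff₀ (by positivity)]
    linarith
  have hv : 0 ≤ redundancyExponent (m + 1) ε + η := by
    have h3 := le_redundancyExponent (m := m + 1) (by omega) hε.le
    push_cast at h3
    have h4 : 1 / (2 * ((m : ℝ) + 1)) ≤ 1 := by
      rw [div_le_one (by positivity)]
      linarith
    linarith
  obtain ⟨n₀, hn₀⟩ := Filter.eventually_atTop.1 (eventually_exists_pirCode hm0 hε h2 hη)
  refine ⟨max n₀ 2, fun n hn => ?_⟩
  obtain ⟨N, F, hF, hN⟩ := hn₀ n ((le_max_left _ _).trans hn)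
  have hn2 : (1 : ℝ) < n := by
    have : 1 < n := (le_max_right n₀ 2).trans hn
    exact_mod_cast this
  have hk : 0 < ⌈(n : ℝ) ^ ε⌉₊ := Nat.ceil_pos.2 (Real.rpow_pos_of_pos (by linarith) _)
  -- For zero redundancy `Real.logb` takes the default value 0, so a nonnegative bound is needed.
  rcases (pirRedundancy_nonneg hk hF).eq_or_lt with h0 | h0
  · rw [← h0, Real.logb_zero]
    exact hv
  · rw [Real.logb_le_iff_le_rpow hn2 h0]
    exact (pirRedundancy_le hF).trans hN

theorem mainTheorem6 :
    (∀ m : ℕ, 1 ≤ m → ∃ C : ℝ, ∀ ε δ : ℝ, 0 < ε → ε < ((m : ℝ) - 1) / m → 0 < δ →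
      ∃ n₀ : ℕ, ∀ n : ℕ, n₀ ≤ n →
        ∃ (N : ℕ) (F : (Fin n → Fin 2) → (Fin N → Fin 2)),
          IsPIRCode F ⌈(n : ℝ) ^ (ε - δ)⌉₊ ∧
          (N : ℝ) - n ≤ C * (n : ℝ) ^ (((m : ℝ) - 1 / 2) / m +
            ε * (1 / 2 + Real.logb 2 (topEigenvalue m) - m) / ((m : ℝ) - 1))) ∧
    (∀ ε : ℝ, 0 < ε → ε < 1 →
      ∃ v : ℝ,
        IsLeast ((fun m : ℕ => (2 * (m : ℝ) - 1) / (2 * m) +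
            (1 + 2 * Real.logb 2 (topEigenvalue m) - 2 * m) / (2 * (m : ℝ) - 2) * ε) ''
          {m : ℕ | ⌈1 / (1 - ε)⌉₊ ≤ m}) v ∧
        ∀ η : ℝ, 0 < η → ∃ n₀ : ℕ, ∀ n : ℕ, n₀ ≤ n →
          Real.logb n (pirRedundancy 2 n ⌈(n : ℝ) ^ ε⌉₊) ≤ v + η) := by

  constructor
  · intro m hm
    -- The constant 1 suffices, because the loss `δ` already absorbs every constant.
    refine ⟨1, fun ε δ hε hε' hδ => ?_⟩
    have hexp : ((m : ℝ) - 1 / 2) / m +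
        ε * (1 / 2 + Real.logb 2 (topEigenvalue m) - m) / ((m : ℝ) - 1) =
        redundancyExponent m ε := by
      have hm0 : (0 : ℝ) < m := by exact_mod_cast hm
      have hm1 : (0 : ℝ) < (m : ℝ) - 1 := by
        by_contra h
        exact absurd (hε.trans hε') (not_lt.2 (div_nonpos_of_nonpos_of_nonneg (not_lt.1 h) hm0.le))
      have h2 : 2 * (m : ℝ) - 2 ≠ 0 := by linarith
      rw [redundancyExponent]
      field_simp
    rw [hexp]
    simp_rw [one_mul]
    exact exists_pirCode_of_lt hm hε hε' hδ
  · intro ε hε hε'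
    obtain ⟨m₀, hm₀, hmin⟩ := exists_isLeast_redundancyExponent hε hε'
    refine ⟨redundancyExponent m₀ ε, ⟨⟨m₀, hm₀, rfl⟩, ?_⟩, fun η hη =>
      exists_logb_pirRedundancy_le hε hε' hm₀ hη⟩
    rintro _ ⟨m, hm, rfl⟩
    exact hmin m hm
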